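/- **Definitions.** A *Markov category* is a symmetric monoidal category $(\mathbf C,\otimes,I)$ whose unit $I$ is terminal and in which every object $X$ carries a commutative comonoid structure with comultiplication $\Delta_X:X\to X\otimes X$ (and counit the unique map $X\to I$), compatible with the tensor product: $\Delta_{X\otimes Y}=(X\otimes\mathsf{swp}\otimes Y)\circ(\Delta_X\otimes\Delta_Y)$. A morphism $f:X\to Y$ is *deterministic* if $\Delta_Y\circ f=(f\otimes f)\circ\Delta_X$. A *distributive Markov category* is a Markov category equipped with chosen finite coproducts such that the canonical maps $X\otimes Z+Y\otimes Z\to(X+Y)\otimes Z$ and $0\to 0\otimes Z$ are isomorphisms and the chosen coproduct injections $X\to X+Y\leftarrow Y$ are deterministic. A *distributive category* is a distributive Markov category in which all morphisms are deterministic (so that $\otimes$ is the categorical product). A *strong monad* $T$ on a category $\mathbf A$ with finite products consists of objects $T(X)$, morphisms $\eta_X:X\to T(X)$ and operations $\mathbf A(Z,T(X))\times\mathbf A(Z\times X,T(Y))\to\mathbf A(Z,T(Y))$, $(f,g)\mapsto f\mathbin{>\!\!>\!=}g$, natural in $Z$ and associative with unit $\eta$. It is *commutative* if for all $f:X_1\to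 T(X_2)$ and $g:X_1\to T(X_3)$ $$f\mathbin{>\!\!>\!=}\bigl((g\circ\pi_1)\mathbin{>\!\!>\!=}(\eta\circ\langle\pi_2\circ\pi_1,\pi_2\rangle)\bigr)=g\mathbin{>\!\!>\!=}\bigl((f\circ\pi_1)\mathbin{>\!\!>\!=}(\eta\circ\langle\pi_2,\pi_2\circ\pi_1\rangle)\bigr),$$ and *affine* if $T(1)\to 1$ is an isomorphism. The Kleisli category $\mathrm{Kl}(T)$ has the objects of $\mathbf A$ and $\mathrm{Kl}(T)(X,Y)=\mathbf A(X,T(Y))$. If $T$ is commutative and affine, $\mathrm{Kl}(T)$ is a Markov category: its tensor product is $X\times Y$ on objects, the tensor product of two Kleisli morphisms runs both and pairs the results, and the coherence isomorphisms and comonoids are the images of those of $\mathbf A$ under $f\mapsto\eta\circ f$. **Proposition 2.6.** Let $\mathbf C$ be a small distributive Markov category, let $\mathbf C_{\mathsf{det}}$ be its wide subcategory of deterministic morphisms, and let $\mathbf A=\mathrm{FP}(\mathbf C_{\mathsf{det}}^{\mathrm{op}},\mathbf{Set})$ be the category of finite-product-preserving functors $\mathbf C_{\mathsf{det}}^{\mathrm{op}}\to\mathbf{Set}$.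 Then $\mathbf A$ is a distributive category, and there are a commutative affine strong monad $T$ on $\mathbf A$ and a full and faithful functor $F:\mathbf C\to\mathrm{Kl}(T)$ that preserves symmetric monoidal structure, comonoids and sums. That is, $F$ is a strong symmetric monoidal functor, with coherence isomorphisms $\mu_{X,Y}:F X\otimes F Y\to F(X\otimes Y)$ and $\varepsilon:I\to F I$; for every object $X$ of $\mathbf C$ one has $F(\Delta_X)=\mu_{X,X}\circ\Delta_{FX}$ and $F(X\to I)=\varepsilon\circ(FX\to I)$; and $F$ preserves finite coproducts. -/

import Mathlib

open CategoryTheory MonoidalCategory CartesianMonoidalCategory Limits ComonObj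

universe v u

/-! ### Distributive Markov categories -/

/-- A distributive Markov category: a Markov category (a symmetric monoidal category with terminal
unit and compatible commutative comonoids) with *chosen* finite coproducts, presented by a chosen
initial object and chosen binary coproducts, such that `- ⊗ Z` preserves them through the canonical
maps, and such that the chosen coproduct injections are deterministic. -/
class DistributiveMarkovCategory (C : Type u) [Category.{v} C] [MonoidalCategory.{v} C] extends
    MarkovCategory C where
  /-- the chosen initial object -/
  zero : C
  zeroIsInitial : IsInitial zero
  /-- the chosen binary coproduct -/
  sum : C → C → C
  inl (X Y : C) : X ⟶ sum X Y
  inr (X Y : C) : Y ⟶ sum X Y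
  sumIsColimit (X Y : C) : IsColimit (BinaryCofan.mk (inl X Y) (inr X Y))
  /-- the canonical map `X ⊗ Z + Y ⊗ Z ⟶ (X + Y) ⊗ Z` is an isomorphism -/
  isIso_distrib (X Y Z : C) :
    IsIso ((sumIsColimit (X ⊗ Z) (Y ⊗ Z)).desc (BinaryCofan.mk (inl X Y ▷ Z) (inr X Y ▷ Z)))
  /-- the canonical map `0 ⟶ 0 ⊗ Z` is an isomorphism -/
  isIso_zero (Z : C) : IsIso (zeroIsInitial.to (zero ⊗ Z))
  deterministic_inl (X Y : C) : Deterministic (inl X Y)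
  deterministic_inr (X Y : C) : Deterministic (inr X Y)

/-- A distributive category: a distributive Markov category in which every morphism is
deterministic. (Then the tensor product is the categorical product.) -/
class DistributiveCategory (C : Type u) [Category.{v} C] [MonoidalCategory.{v} C] extends
    DistributiveMarkovCategory C where
  deterministic {X Y : C} (f : X ⟶ Y) : Deterministic f

/-- The deterministic morphisms of a Markov category. -/
def deterministicMorphisms (C : Type u) [Category.{v} C] [MonoidalCategory.{v} C]
    [MarkovCategory C] : MorphismProperty C :=
  fun _ _ f => Deterministic f

instance (C : Type u) [Category.{v} C] [MonoidalCategory.{v} C] [MarkovCategory C] :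
    (deterministicMorphisms C).IsMultiplicative where
  id_mem X := inferInstanceAs (IsComonHom (𝟙 X))
  comp_mem f g hf hg := by
    have : IsComonHom f := hf
    have : IsComonHom g := hg
    exact inferInstanceAs (IsComonHom (f ≫ g))

/-- The wide subcategory of deterministic morphisms. -/
abbrev DetSubcategory (C : Type u) [Category.{v} C] [MonoidalCategory.{v} C]
    [MarkovCategory C] : Type u :=
  WideSubcategory (deterministicMorphisms C)

/-- The category of finite-product-preserving presheaves of sets on a category `D`: the full
subcategory of `Dᵒᵖ ⥤ Type u` on the functors that preserve finite products (so they turn the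
finite coproducts of `D` into products of sets). -/
abbrev FinProdPresheaf (D : Type u) [Category.{u} D] : Type (u + 1) :=
  ObjectProperty.FullSubcategory (fun F : Dᵒᵖ ⥤ Type u => PreservesFiniteProducts F)

/-! ### Strong monads and their Kleisli categories -/

/-- A strong monad on a category with finite products: objects `T X`, units `η`, and a bind
operation `A(Z, T X) × A(Z × X, T Y) → A(Z, T Y)`, natural in `Z` and associative with unit `η`. -/
structure StrongMonad (A : Type u) [Category.{v} A] [CartesianMonoidalCategory A] where
  obj : A → A
  η (X : A) : X ⟶ obj X
  bind {Z X Y : A} (f : Z ⟶ obj X) (g : Z ⊗ X ⟶ obj Y) : Z ⟶ obj Y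
  bind_natural {W Z X Y : A} (h : W ⟶ Z) (f : Z ⟶ obj X) (g : Z ⊗ X ⟶ obj Y) :
    h ≫ bind f g = bind (h ≫ f) (h ▷ X ≫ g)
  unit_bind {Z X Y : A} (f : Z ⟶ X) (g : Z ⊗ X ⟶ obj Y) :
    bind (f ≫ η X) g = lift (𝟙 Z) f ≫ g
  bind_unit {Z X : A} (f : Z ⟶ obj X) : bind f (snd Z X ≫ η X) = f
  bind_assoc {Z X Y W : A} (f : Z ⟶ obj X) (g : Z ⊗ X ⟶ obj Y) (h : Z ⊗ Y ⟶ obj W) :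
    bind (bind f g) h = bind f (bind g (fst Z X ▷ Y ≫ h))

namespace StrongMonad

variable {A : Type u} [Category.{v} A] [CartesianMonoidalCategory A] (T : StrongMonad A)

/-- A strong monad is commutative if any two `f : X₁ ⟶ T X₂` and `g : X₁ ⟶ T X₃` commute. -/
class IsCommutative : Prop where
  comm {X₁ X₂ X₃ : A} (f : X₁ ⟶ T.obj X₂) (g : X₁ ⟶ T.obj X₃) :
    T.bind f (T.bind (fst X₁ X₂ ≫ g)
        (lift (fst (X₁ ⊗ X₂) X₃ ≫ snd X₁ X₂) (snd (X₁ ⊗ X₂) X₃) ≫ T.η (X₂ ⊗ X₃))) =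
      T.bind g (T.bind (fst X₁ X₃ ≫ f)
        (lift (snd (X₁ ⊗ X₃) X₂) (fst (X₁ ⊗ X₃) X₂ ≫ snd X₁ X₃) ≫ T.η (X₂ ⊗ X₃)))

/-- A strong monad is affine if `T 1 ⟶ 1` is an isomorphism. -/
class IsAffine : Prop where
  isIso_toUnit : IsIso (toUnit (T.obj (𝟙_ A)))

/-- The effect-free computation given by a morphism of the base. -/
def pure {Z X : A} (f : Z ⟶ X) : Z ⟶ T.obj X := f ≫ T.η X

theorem pure_eq {Z X : A} (f : Z ⟶ X) : f ≫ T.η X = T.pure f := rfl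

theorem comp_pure {W Z X : A} (h : W ⟶ Z) (f : Z ⟶ X) : h ≫ T.pure f = T.pure (h ≫ f) := by
  simp [pure]

theorem comp_bind {W Z X Y : A} (h : W ⟶ Z) (f : Z ⟶ T.obj X) (g : Z ⊗ X ⟶ T.obj Y) :
    h ≫ T.bind f g = T.bind (h ≫ f) (lift (fst _ _ ≫ h) (snd _ _) ≫ g) := by
  rw [bind_natural]; congr 2; ext <;> simp

theorem pure_bind {Z X Y : A} (f : Z ⟶ X) (g : Z ⊗ X ⟶ T.obj Y) :
    T.bind (T.pure f) g = lift (𝟙 Z) f ≫ g := T.unit_bind f g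

theorem bind_pure {Z X : A} (f : Z ⟶ T.obj X) : T.bind f (T.pure (snd Z X)) = f :=
  T.bind_unit f

theorem bind_bind {Z X Y W : A} (f : Z ⟶ T.obj X) (g : Z ⊗ X ⟶ T.obj Y)
    (h : Z ⊗ Y ⟶ T.obj W) :
    T.bind (T.bind f g) h =
      T.bind f (T.bind g (lift (fst _ _ ≫ fst _ _) (snd _ _) ≫ h)) := by
  rw [T.bind_assoc]; congr 3; ext <;> simp

theorem bind_comm [T.IsCommutative] {Z X₂ X₃ Y : A} (f : Z ⟶ T.obj X₂) (g : Z ⟶ T.obj X₃)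
    (k : (Z ⊗ X₂) ⊗ X₃ ⟶ T.obj Y) :
    T.bind f (T.bind (fst _ _ ≫ g) k) =
      T.bind g (T.bind (fst _ _ ≫ f)
        (lift (lift (fst _ _ ≫ fst _ _) (snd _ _)) (fst _ _ ≫ snd _ _) ≫ k)) := by
  have h := congrArg (fun m => T.bind m ((α_ Z X₂ X₃).inv ≫ k)) (IsCommutative.comm (T := T) f g)
  have e : (α_ Z X₂ X₃).inv =
      lift (lift (fst _ _) (snd _ _ ≫ fst _ _)) (snd _ _ ≫ snd _ _) := by
    ext <;> simp
  have e₁ : lift (lift (fst (Z ⊗ X₂) X₃ ≫ fst Z X₂) (fst (Z ⊗ X₂) X₃ ≫ snd Z X₂))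
      (snd (Z ⊗ X₂) X₃) = 𝟙 _ := by
    ext <;> simp
  simpa only [pure_eq, bind_bind, comp_bind, pure_bind, e, comp_lift_assoc, comp_lift,
    lift_fst, lift_snd, lift_fst_assoc, lift_snd_assoc, Category.assoc, Category.comp_id,
    Category.id_comp, comp_pure, e₁] using h

/-- The Kleisli category of `T`: its objects are those of the base. -/
structure Kl (T : StrongMonad A) where
  of : A

variable {T}

namespace Kl

/-- A Kleisli morphism from `X` to `Y` is a morphism `X ⟶ T Y` of the base. -/
structure Hom (X Y : T.Kl) where
  hom : X.of ⟶ T.obj Y.of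

/-- Kleisli composition: `f` followed by `g`. -/
instance : Category T.Kl where
  Hom X Y := Hom X Y
  id X := ⟨T.pure (𝟙 X.of)⟩
  comp {X Y _} f g := ⟨T.bind f.hom (snd X.of Y.of ≫ g.hom)⟩
  id_comp f := by
    simp [pure_bind]
  comp_id f := by
    simp [comp_pure, T.bind_pure]
  assoc f g h := by
    simp [bind_bind, comp_bind]

@[ext]
theorem hom_ext {X Y : T.Kl} {f g : X ⟶ Y} (h : f.hom = g.hom) : f = g := by
  exact congrArg (fun m => (⟨m⟩ : Hom X Y)) h

theorem id_hom (X : T.Kl) : Hom.hom (𝟙 X) = T.pure (𝟙 X.of) := rfl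

theorem comp_hom {X Y Z : T.Kl} (f : X ⟶ Y) (g : Y ⟶ Z) :
    (f ≫ g).hom = T.bind f.hom (snd X.of Y.of ≫ g.hom) := rfl

variable (T) in
/-- The identity-on-objects functor from the base to the Kleisli category, `f ↦ f ≫ η`. -/
def incl : A ⥤ T.Kl where
  obj X := ⟨X⟩
  map f := ⟨T.pure f⟩
  map_comp f g := by
    apply hom_ext
    simp [comp_hom, pure_bind, comp_pure]

/-- The tensor product of Kleisli morphisms: run the first, run the second, and pair the results;
the objects and the coherence isomorphisms are those of the cartesian structure of the base. -/
instance : MonoidalCategoryStruct T.Kl where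
  tensorObj X Y := ⟨X.of ⊗ Y.of⟩
  tensorUnit := ⟨𝟙_ A⟩
  tensorHom {X₁ Y₁ X₂ Y₂} f g :=
    ⟨T.bind (fst X₁.of X₂.of ≫ f.hom) (T.bind (fst _ _ ≫ snd X₁.of X₂.of ≫ g.hom)
      (T.pure (lift (fst _ Y₂.of ≫ snd _ Y₁.of) (snd _ Y₂.of))))⟩
  whiskerLeft X {Y₁ Y₂} g :=
    ⟨T.bind (snd X.of Y₁.of ≫ g.hom) (T.pure (lift (fst _ _ ≫ fst _ _) (snd _ Y₂.of)))⟩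
  whiskerRight {X₁ X₂} f Y :=
    ⟨T.bind (fst X₁.of Y.of ≫ f.hom) (T.pure (lift (snd _ X₂.of) (fst _ _ ≫ snd _ _)))⟩
  associator X Y Z := (incl T).mapIso (α_ X.of Y.of Z.of)
  leftUnitor X := (incl T).mapIso (λ_ X.of)
  rightUnitor X := (incl T).mapIso (ρ_ X.of)

theorem tensorObj_of (X Y : T.Kl) : (X ⊗ Y).of = X.of ⊗ Y.of := rfl

theorem tensorUnit_of : (𝟙_ T.Kl).of = 𝟙_ A := rfl

theorem tensorHom_hom {X₁ Y₁ X₂ Y₂ : T.Kl} (f : X₁ ⟶ Y₁) (g : X₂ ⟶ Y₂) :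
    (f ⊗ₘ g).hom = T.bind (fst X₁.of X₂.of ≫ f.hom) (T.bind (fst _ _ ≫ snd X₁.of X₂.of ≫ g.hom)
      (T.pure (lift (fst _ Y₂.of ≫ snd _ Y₁.of) (snd _ Y₂.of)))) := rfl

theorem whiskerLeft_hom (X : T.Kl) {Y₁ Y₂ : T.Kl} (g : Y₁ ⟶ Y₂) :
    (X ◁ g).hom =
      T.bind (snd X.of Y₁.of ≫ g.hom) (T.pure (lift (fst _ _ ≫ fst _ _) (snd _ Y₂.of))) := rfl

theorem whiskerRight_hom {X₁ X₂ : T.Kl} (f : X₁ ⟶ X₂) (Y : T.Kl) :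
    (f ▷ Y).hom =
      T.bind (fst X₁.of Y.of ≫ f.hom) (T.pure (lift (snd _ X₂.of) (fst _ _ ≫ snd _ _))) := rfl

theorem associator_hom_hom (X Y Z : T.Kl) :
    (α_ X Y Z).hom.hom = T.pure (lift (fst _ _ ≫ fst _ _) (lift (fst _ _ ≫ snd _ _) (snd _ _))) := by
  change T.pure (α_ X.of Y.of Z.of).hom = _
  congr 1; ext <;> simp

theorem associator_inv_hom (X Y Z : T.Kl) :
    (α_ X Y Z).inv.hom =
      T.pure (lift (lift (fst _ _) (snd _ _ ≫ fst _ _)) (snd _ _ ≫ snd _ _)) := by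
  change T.pure (α_ X.of Y.of Z.of).inv = _
  congr 1; ext <;> simp

theorem leftUnitor_hom_hom (X : T.Kl) : (λ_ X).hom.hom = T.pure (snd (𝟙_ A) X.of) :=
  congrArg T.pure (leftUnitor_hom X.of)

theorem rightUnitor_hom_hom (X : T.Kl) : (ρ_ X).hom.hom = T.pure (fst X.of (𝟙_ A)) :=
  congrArg T.pure (rightUnitor_hom X.of)

theorem leftUnitor_inv_hom (X : T.Kl) :
    (λ_ X).inv.hom = T.pure (lift (toUnit X.of) (𝟙 X.of)) := by
  change T.pure (λ_ X.of).inv = _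
  congr 1; ext; simp

theorem rightUnitor_inv_hom (X : T.Kl) :
    (ρ_ X).inv.hom = T.pure (lift (𝟙 X.of) (toUnit X.of)) := by
  change T.pure (ρ_ X.of).inv = _
  congr 1; ext; simp

theorem incl_map_hom {X Y : A} (f : X ⟶ Y) : ((incl T).map f).hom = T.pure f := rfl

/-- The braiding is the swap map of the base. -/
def swap (X Y : T.Kl) : X ⊗ Y ≅ Y ⊗ X :=
  (incl T).mapIso
    ⟨lift (snd X.of Y.of) (fst X.of Y.of), lift (snd Y.of X.of) (fst Y.of X.of), by simp, by simp⟩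

theorem swap_hom_hom (X Y : T.Kl) :
    (swap X Y).hom.hom = T.pure (lift (snd X.of Y.of) (fst X.of Y.of)) := rfl

theorem swap_inv (X Y : T.Kl) : (swap X Y).inv = (swap Y X).hom := rfl

variable [T.IsCommutative]

set_option linter.unusedSimpArgs false

/-- The symmetric monoidal structure of the Kleisli category of a commutative strong monad. -/
instance : MonoidalCategory T.Kl := .ofTensorHom
  (id_tensorHom_id := by
    intros
    apply hom_ext
    simp [tensorHom_hom, comp_hom, id_hom, comp_bind, comp_pure, pure_bind, bind_bind, T.bind_pure,
      whiskerLeft_hom, whiskerRight_hom, associator_hom_hom, leftUnitor_hom_hom,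
      rightUnitor_hom_hom, tensorObj_of, tensorUnit_of])
  (id_tensorHom := by
    intros
    apply hom_ext
    simp [tensorHom_hom, comp_hom, id_hom, comp_bind, comp_pure, pure_bind, bind_bind, T.bind_pure,
      whiskerLeft_hom, whiskerRight_hom, associator_hom_hom, leftUnitor_hom_hom,
      rightUnitor_hom_hom, tensorObj_of, tensorUnit_of])
  (tensorHom_id := by
    intros
    apply hom_ext
    simp [tensorHom_hom, comp_hom, id_hom, comp_bind, comp_pure, pure_bind, bind_bind, T.bind_pure,
      whiskerLeft_hom, whiskerRight_hom, associator_hom_hom, leftUnitor_hom_hom,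
      rightUnitor_hom_hom, tensorObj_of, tensorUnit_of])
  (tensorHom_comp_tensorHom := by
    intro _ _ _ _ _ _ f₁ f₂ g₁ g₂
    apply hom_ext
    simp [tensorHom_hom, comp_hom, id_hom, comp_bind, comp_pure, pure_bind, bind_bind, T.bind_pure,
      whiskerLeft_hom, whiskerRight_hom, associator_hom_hom, leftUnitor_hom_hom,
      rightUnitor_hom_hom, tensorObj_of, tensorUnit_of]
    congr 1
    rw [bind_comm (f := snd _ _ ≫ g₁.hom)]
    simp [tensorHom_hom, comp_hom, id_hom, comp_bind, comp_pure, pure_bind, bind_bind, T.bind_pure,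
      whiskerLeft_hom, whiskerRight_hom, associator_hom_hom, leftUnitor_hom_hom,
      rightUnitor_hom_hom, tensorObj_of, tensorUnit_of])
  (associator_naturality := by
    intros
    apply hom_ext
    simp [tensorHom_hom, comp_hom, id_hom, comp_bind, comp_pure, pure_bind, bind_bind, T.bind_pure,
      whiskerLeft_hom, whiskerRight_hom, associator_hom_hom, leftUnitor_hom_hom,
      rightUnitor_hom_hom, tensorObj_of, tensorUnit_of])
  (leftUnitor_naturality := by
    intros
    apply hom_ext
    simp [tensorHom_hom, comp_hom, id_hom, comp_bind, comp_pure, pure_bind, bind_bind, T.bind_pure,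
      whiskerLeft_hom, whiskerRight_hom, associator_hom_hom, leftUnitor_hom_hom,
      rightUnitor_hom_hom, tensorObj_of, tensorUnit_of])
  (rightUnitor_naturality := by
    intros
    apply hom_ext
    simp [tensorHom_hom, comp_hom, id_hom, comp_bind, comp_pure, pure_bind, bind_bind, T.bind_pure,
      whiskerLeft_hom, whiskerRight_hom, associator_hom_hom, leftUnitor_hom_hom,
      rightUnitor_hom_hom, tensorObj_of, tensorUnit_of])
  (pentagon := by
    intros
    apply hom_ext
    simp [tensorHom_hom, comp_hom, id_hom, comp_bind, comp_pure, pure_bind, bind_bind, T.bind_pure,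
      whiskerLeft_hom, whiskerRight_hom, associator_hom_hom, leftUnitor_hom_hom,
      rightUnitor_hom_hom, tensorObj_of, tensorUnit_of])
  (triangle := by
    intros
    apply hom_ext
    simp [tensorHom_hom, comp_hom, id_hom, comp_bind, comp_pure, pure_bind, bind_bind, T.bind_pure,
      whiskerLeft_hom, whiskerRight_hom, associator_hom_hom, leftUnitor_hom_hom,
      rightUnitor_hom_hom, tensorObj_of, tensorUnit_of])

instance : BraidedCategory T.Kl where
  braiding := swap
  braiding_naturality_right := by
    intros
    apply hom_ext
    simp [tensorHom_hom, comp_hom, id_hom, comp_bind, comp_pure, pure_bind, bind_bind, T.bind_pure,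
      whiskerLeft_hom, whiskerRight_hom, associator_hom_hom, leftUnitor_hom_hom,
      rightUnitor_hom_hom, tensorObj_of, tensorUnit_of,
      associator_inv_hom, leftUnitor_inv_hom, rightUnitor_inv_hom, swap_hom_hom, incl_map_hom]
  braiding_naturality_left := by
    intros
    apply hom_ext
    simp [tensorHom_hom, comp_hom, id_hom, comp_bind, comp_pure, pure_bind, bind_bind, T.bind_pure,
      whiskerLeft_hom, whiskerRight_hom, associator_hom_hom, leftUnitor_hom_hom,
      rightUnitor_hom_hom, tensorObj_of, tensorUnit_of,
      associator_inv_hom, leftUnitor_inv_hom, rightUnitor_inv_hom, swap_hom_hom, incl_map_hom]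
  hexagon_forward := by
    intros
    apply hom_ext
    simp [tensorHom_hom, comp_hom, id_hom, comp_bind, comp_pure, pure_bind, bind_bind, T.bind_pure,
      whiskerLeft_hom, whiskerRight_hom, associator_hom_hom, leftUnitor_hom_hom,
      rightUnitor_hom_hom, tensorObj_of, tensorUnit_of,
      associator_inv_hom, leftUnitor_inv_hom, rightUnitor_inv_hom, swap_hom_hom, incl_map_hom]
  hexagon_reverse := by
    intros
    apply hom_ext
    simp [tensorHom_hom, comp_hom, id_hom, comp_bind, comp_pure, pure_bind, bind_bind, T.bind_pure,
      whiskerLeft_hom, whiskerRight_hom, associator_hom_hom, leftUnitor_hom_hom,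
      rightUnitor_hom_hom, tensorObj_of, tensorUnit_of,
      associator_inv_hom, leftUnitor_inv_hom, rightUnitor_inv_hom, swap_hom_hom, incl_map_hom]

theorem braiding_eq (X Y : T.Kl) : β_ X Y = swap X Y := rfl

instance : SymmetricCategory T.Kl where
  symmetry X Y := by
    apply hom_ext
    simp [tensorHom_hom, comp_hom, id_hom, comp_bind, comp_pure, pure_bind, bind_bind, T.bind_pure,
      whiskerLeft_hom, whiskerRight_hom, associator_hom_hom, leftUnitor_hom_hom,
      rightUnitor_hom_hom, tensorObj_of, tensorUnit_of,
      associator_inv_hom, leftUnitor_inv_hom, rightUnitor_inv_hom, swap_hom_hom, incl_map_hom, braiding_eq]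

/-- Every object carries the image of its diagonal comonoid in the base. -/
instance (X : T.Kl) : ComonObj X where
  counit := ⟨T.pure (toUnit X.of)⟩
  comul := ⟨T.pure (lift (𝟙 X.of) (𝟙 X.of))⟩
  counit_comul := by
    apply hom_ext
    simp [tensorHom_hom, comp_hom, id_hom, comp_bind, comp_pure, pure_bind, bind_bind, T.bind_pure,
      whiskerLeft_hom, whiskerRight_hom, associator_hom_hom, leftUnitor_hom_hom,
      rightUnitor_hom_hom, tensorObj_of, tensorUnit_of,
      associator_inv_hom, leftUnitor_inv_hom, rightUnitor_inv_hom, swap_hom_hom, incl_map_hom]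
  comul_counit := by
    apply hom_ext
    simp [tensorHom_hom, comp_hom, id_hom, comp_bind, comp_pure, pure_bind, bind_bind, T.bind_pure,
      whiskerLeft_hom, whiskerRight_hom, associator_hom_hom, leftUnitor_hom_hom,
      rightUnitor_hom_hom, tensorObj_of, tensorUnit_of,
      associator_inv_hom, leftUnitor_inv_hom, rightUnitor_inv_hom, swap_hom_hom, incl_map_hom]
  comul_assoc := by
    apply hom_ext
    simp [tensorHom_hom, comp_hom, id_hom, comp_bind, comp_pure, pure_bind, bind_bind, T.bind_pure,
      whiskerLeft_hom, whiskerRight_hom, associator_hom_hom, leftUnitor_hom_hom,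
      rightUnitor_hom_hom, tensorObj_of, tensorUnit_of,
      associator_inv_hom, leftUnitor_inv_hom, rightUnitor_inv_hom, swap_hom_hom, incl_map_hom]

theorem counit_hom (X : T.Kl) : (ε[X]).hom = T.pure (toUnit X.of) := rfl

theorem comul_hom (X : T.Kl) : (Δ[X]).hom = T.pure (lift (𝟙 X.of) (𝟙 X.of)) := rfl

instance (X : T.Kl) : IsCommComonObj X where
  comul_comm := by
    apply hom_ext
    simp [tensorHom_hom, comp_hom, id_hom, comp_bind, comp_pure, pure_bind, bind_bind, T.bind_pure,
      whiskerLeft_hom, whiskerRight_hom, associator_hom_hom, leftUnitor_hom_hom,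
      rightUnitor_hom_hom, tensorObj_of, tensorUnit_of,
      associator_inv_hom, leftUnitor_inv_hom, rightUnitor_inv_hom, swap_hom_hom, incl_map_hom, braiding_eq, comul_hom]

/-- The Kleisli category of a commutative strong monad is a copy-discard category. -/
instance : CopyDiscardCategory T.Kl where
  copy_tensor := by
    intros
    apply hom_ext
    simp [tensorHom_hom, comp_hom, id_hom, comp_bind, comp_pure, pure_bind, bind_bind, T.bind_pure,
      whiskerLeft_hom, whiskerRight_hom, associator_hom_hom, leftUnitor_hom_hom,
      rightUnitor_hom_hom, tensorObj_of, tensorUnit_of,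
      associator_inv_hom, leftUnitor_inv_hom, rightUnitor_inv_hom, swap_hom_hom, incl_map_hom, braiding_eq, comul_hom, counit_hom, tensorμ]
  discard_tensor := by
    intros
    apply hom_ext
    simp [tensorHom_hom, comp_hom, id_hom, comp_bind, comp_pure, pure_bind, bind_bind, T.bind_pure,
      whiskerLeft_hom, whiskerRight_hom, associator_hom_hom, leftUnitor_hom_hom,
      rightUnitor_hom_hom, tensorObj_of, tensorUnit_of,
      associator_inv_hom, leftUnitor_inv_hom, rightUnitor_inv_hom, swap_hom_hom, incl_map_hom, braiding_eq, comul_hom, counit_hom, tensorμ]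
  copy_unit := by
    apply hom_ext
    simp [tensorHom_hom, comp_hom, id_hom, comp_bind, comp_pure, pure_bind, bind_bind, T.bind_pure,
      whiskerLeft_hom, whiskerRight_hom, associator_hom_hom, leftUnitor_hom_hom,
      rightUnitor_hom_hom, tensorObj_of, tensorUnit_of,
      associator_inv_hom, leftUnitor_inv_hom, rightUnitor_inv_hom, swap_hom_hom, incl_map_hom, braiding_eq, comul_hom, counit_hom, tensorμ]
  discard_unit := by
    apply hom_ext
    simp [tensorHom_hom, comp_hom, id_hom, comp_bind, comp_pure, pure_bind, bind_bind, T.bind_pure,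
      whiskerLeft_hom, whiskerRight_hom, associator_hom_hom, leftUnitor_hom_hom,
      rightUnitor_hom_hom, tensorObj_of, tensorUnit_of,
      associator_inv_hom, leftUnitor_inv_hom, rightUnitor_inv_hom, swap_hom_hom, incl_map_hom, braiding_eq, comul_hom, counit_hom, tensorμ]

/-- The Kleisli category of a commutative affine strong monad is a Markov category. -/
instance [T.IsAffine] : MarkovCategory T.Kl where
  discard_natural {X Y} f := by
    apply hom_ext
    have : Mono (toUnit (T.obj (𝟙_ A))) := by
      have := IsAffine.isIso_toUnit (T := T)
      infer_instance
    exact (cancel_mono (toUnit (T.obj (𝟙_ A)))).1 (toUnit_unique _ _)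

end Kl
end StrongMonad

/-!
Write `D` for the category of deterministic morphisms of `C`. Copying, discarding and the coherence
morphisms are deterministic, so `⊗` restricts to the categorical product of `D`; the chosen sums
restrict to `D` as well, and `D` is a distributive category.

**The category of presheaves is distributive.** Let `A` be the category of presheaves on `D` that
turn finite sums into products. Finite products of such presheaves are computed elementwise. The sum
of `F` and `G` is given by the coend of `F X₁ × G X₂ × (Z ⟶ X₁ + X₂)` over `X₁` and `X₂`: an element
of it is a decomposition of `Z` together with elements of `F` and `G` at the two parts. The elements
of this coend at a sum are the pairs of elements at the summands because elements of `F` and of `G`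
can be glued along sums. Since `D` is distributive, a decomposition `Z ⟶ X₁ + X₂` factors through
`X₁ ⊗ Z + X₂ ⊗ Z` (`DetSubcategory.split`). Hence an element of `(F + G) ⊗ H` amounts to elements of
`F ⊗ H` and `G ⊗ H` at the two parts, which shows at once that `F + G` is a coproduct and that the
product with `H` preserves it.

**The monad.** The monad sends a presheaf `P` to its left Kan extension along the inclusion of `D`
into `C`, restricted back to `D`. An element of `T P` at `Z` is thus a morphism `φ : Z ⟶ B` of `C`
followed by an element of `P` at `B`, where deterministic morphisms may be moved across. Again
gluing shows that `T P` preserves finite products. The bind operation evaluates the second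
computation at `Z ⊗ B` and precomposes with the graph `Z ⟶ Z ⊗ B` of `φ`, which is `φ` run on a
copy of the input. Naturality in the context holds because deterministic morphisms commute with
copying, associativity is coassociativity of copying (`graph_graph_proj₁`), commutativity of the
monad is the interchange law for `⊗` together with cocommutativity of copying (`graph_graph_proj₂`,
`graph_graph_swap`), and the monad is affine because the unit of `C` is terminal.

**The embedding.** The functor sends `X` to the presheaf `D(-, X)`. By the Yoneda lemma, Kleisli
morphisms from `D(-, X)` to `D(-, Y)` are elements of `T D(-, Y)` at `X`, and these are just the
morphisms `X ⟶ Y` of `C` (`compMk_collapse`), so the functor is full and faithful. On deterministic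
morphisms it is the Yoneda embedding of `D` followed by the inclusion into the Kleisli category
(`embedding_map_hom`), and the Yoneda embedding preserves finite products; this provides the
monoidal structure and the compatibility with the comonoids. Finally, Kleisli morphisms from
`D(-, X + Y)` to `P` are elements of `T P` at `X + Y`, that is, pairs of elements of `T P` at `X` and
at `Y`, so the functor preserves finite sums.
-/

open Opposite

/-! ### Deterministic morphisms of a Markov category -/

namespace CategoryTheory.MarkovCategory

variable {C : Type u} [Category.{v} C] [MonoidalCategory C] [MarkovCategory C]

open CopyDiscardCategory

theorem deterministic_of_comul {X Y : C} {f : X ⟶ Y} (h : f ≫ Δ = Δ ≫ (f ⊗ₘ f)) :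
    Deterministic f :=
  ⟨discard_natural f, h⟩

/-- The comultiplication of `X`, for the comonoid structure that belongs to the Markov category.
Writing `Δ[X ⊗ Y]` would select the tensor product of the comonoids `X` and `Y` instead. -/
abbrev copy (X : C) : X ⟶ X ⊗ X := Δ[X]

theorem copy_braiding (X : C) : copy X ≫ (β_ X X).hom = copy X :=
  IsCommComonObj.comul_comm X

/-- Copying four times is insensitive to exchanging the two middle copies. -/
theorem copy_interchange (X : C) :
    Δ[X] ≫ (Δ[X] ⊗ₘ Δ[X]) ≫ tensorμ X X X X = Δ[X] ≫ (Δ[X] ⊗ₘ Δ[X]) := by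
  have e : Δ[X] ≫ (Δ[X] ⊗ₘ Δ[X]) ≫ (α_ X X (X ⊗ X)).hom =
      Δ[X] ≫ X ◁ (Δ[X] ≫ Δ[X] ▷ X ≫ (α_ X X X).hom) := by
    rw [← comul_assoc, MonoidalCategory.whiskerLeft_comp, comul_assoc_assoc,
      MonoidalCategory.tensorHom_def]
    simp
  have h : Δ[X] ▷ X ≫ (β_ X X).hom ▷ X = Δ[X] ▷ X := by
    rw [← comp_whiskerRight, IsCommComonObj.comul_comm]
  rw [tensorμ, reassoc_of% e]
  simp only [← MonoidalCategory.whiskerLeft_comp_assoc, Category.assoc, Iso.hom_inv_id_assoc,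
    reassoc_of% h]
  rw [← reassoc_of% e, Iso.hom_inv_id, Category.comp_id]

theorem deterministic_copy (X : C) : Deterministic Δ[X] :=
  deterministic_of_comul (by rw [copy_tensor, copy_interchange])

theorem deterministic_tensorHom {X₁ X₂ Y₁ Y₂ : C} (f : X₁ ⟶ Y₁) (g : X₂ ⟶ Y₂)
    (hf : Deterministic f) (hg : Deterministic g) : Deterministic (f ⊗ₘ g) :=
  deterministic_of_comul (by
    rw [copy_tensor, copy_tensor, tensorHom_comp_tensorHom_assoc, hf.hom_comul, hg.hom_comul,
      ← tensorHom_comp_tensorHom_assoc, tensorμ_natural, Category.assoc])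

theorem deterministic_associator (X Y Z : C) : Deterministic (α_ X Y Z).hom :=
  deterministic_of_comul (by
    have h := tensor_associativity X X Y Y Z Z
    simp only [copy_tensor, Category.assoc]
    rw [← Category.comp_id Δ[X], ← Category.comp_id Δ[Z]]
    simp only [← tensorHom_comp_tensorHom, Category.assoc, tensorHom_id, id_tensorHom]
    rw [h]
    simp)

theorem deterministic_leftUnitor (X : C) : Deterministic (λ_ X).hom :=
  deterministic_of_comul (by
    rw [copy_tensor, copy_unit, MonoidalCategory.tensorHom_def', Category.assoc, Category.assoc,
      ← tensor_left_unitality, leftUnitor_naturality])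

theorem deterministic_rightUnitor (X : C) : Deterministic (ρ_ X).hom :=
  deterministic_of_comul (by
    rw [copy_tensor, copy_unit, MonoidalCategory.tensorHom_def, Category.assoc, Category.assoc,
      ← tensor_right_unitality, rightUnitor_naturality])

theorem deterministic_discard (X : C) : Deterministic ε[X] :=
  deterministic_of_comul (by
    rw [copy_unit, counit_comul_hom])

theorem deterministic_inv {X Y : C} (e : X ≅ Y) (h : Deterministic e.hom) :
    Deterministic e.inv :=
  inferInstance

theorem deterministic_comp {X Y Z : C} {f : X ⟶ Y} {g : Y ⟶ Z} (hf : Deterministic f)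
    (hg : Deterministic g) : Deterministic (f ≫ g) :=
  inferInstance

theorem deterministic_whiskerLeft (X : C) {Y Z : C} {f : Y ⟶ Z} (hf : Deterministic f) :
    Deterministic (X ◁ f) := by
  rw [← id_tensorHom]
  exact deterministic_tensorHom _ _ inferInstance hf

theorem deterministic_whiskerRight {Y Z : C} {f : Y ⟶ Z} (hf : Deterministic f) (X : C) :
    Deterministic (f ▷ X) := by
  rw [← tensorHom_id]
  exact deterministic_tensorHom _ _ hf inferInstance

/-- The pairing of the two marginalisations of a tensor product is the identity. -/
theorem copy_projections (X Y : C) :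
    copy (X ⊗ Y) ≫ ((X ◁ ε[Y] ≫ (ρ_ X).hom) ⊗ₘ (ε[X] ▷ Y ≫ (λ_ Y).hom)) = 𝟙 (X ⊗ Y) := by
  have h : tensorμ X (𝟙_ C) (𝟙_ C) Y ≫ ((ρ_ X).hom ⊗ₘ (λ_ Y).hom) =
      (ρ_ X).hom ⊗ₘ (λ_ Y).hom := by
    rw [tensorμ, braiding_tensorUnit_left]
    monoidal
  rw [copy, copy_tensor, ← tensorHom_comp_tensorHom, ← id_tensorHom, ← tensorHom_id, Category.assoc,
    ← tensorμ_natural_assoc, h, tensorHom_comp_tensorHom_assoc, tensorHom_comp_tensorHom]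
  simp

theorem copy_projections_swap (X Y : C) :
    copy (X ⊗ Y) ≫ ((ε[X] ▷ Y ≫ (λ_ Y).hom) ⊗ₘ (X ◁ ε[Y] ≫ (ρ_ X).hom)) = (β_ X Y).hom := by
  rw [← copy_braiding, Category.assoc, ← BraidedCategory.braiding_naturality,
    reassoc_of% copy_projections]

theorem pair_fst {X Y Z : C} (f : X ⟶ Y) (g : X ⟶ Z) :
    (Δ[X] ≫ (f ⊗ₘ g)) ≫ Y ◁ ε[Z] ≫ (ρ_ Y).hom = f := by
  have : (f ⊗ₘ g) ≫ Y ◁ ε[Z] = f ⊗ₘ ε[X] := by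
    rw [← id_tensorHom, tensorHom_comp_tensorHom, Category.comp_id, discard_natural]
  rw [Category.assoc, reassoc_of% this]
  simp

theorem pair_snd {X Y Z : C} (f : X ⟶ Y) (g : X ⟶ Z) :
    (Δ[X] ≫ (f ⊗ₘ g)) ≫ ε[Y] ▷ Z ≫ (λ_ Z).hom = g := by
  have : (f ⊗ₘ g) ≫ ε[Y] ▷ Z = ε[X] ⊗ₘ g := by
    rw [← tensorHom_id, tensorHom_comp_tensorHom, Category.comp_id, discard_natural]
  rw [Category.assoc, reassoc_of% this]
  simp

/-- Deterministic morphisms into a tensor product are determined by their marginals. -/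
theorem eq_pair {X Y Z : C} (m : Z ⟶ X ⊗ Y) (hm : Deterministic m) :
    m = Δ[Z] ≫ ((m ≫ X ◁ ε[Y] ≫ (ρ_ X).hom) ⊗ₘ (m ≫ ε[X] ▷ Y ≫ (λ_ Y).hom)) := by
  rw [← tensorHom_comp_tensorHom, ← hm.hom_comul_assoc, copy_projections, Category.comp_id]

theorem deterministic_fst (X Y : C) : Deterministic (X ◁ ε[Y] ≫ (ρ_ X).hom) :=
  deterministic_comp (deterministic_whiskerLeft _ (deterministic_discard Y))
    (deterministic_rightUnitor X)

theorem deterministic_snd (X Y : C) : Deterministic (ε[X] ▷ Y ≫ (λ_ Y).hom) :=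
  deterministic_comp (deterministic_whiskerRight (deterministic_discard X) Y)
    (deterministic_leftUnitor Y)

theorem deterministic_braiding (X Y : C) : Deterministic (β_ X Y).hom := by
  rw [← copy_projections_swap]
  exact deterministic_comp (deterministic_copy _)
    (deterministic_tensorHom _ _ (deterministic_snd X Y) (deterministic_fst X Y))

instance : (deterministicMorphisms C).IsStableUnderBraiding where
  id_mem := MorphismProperty.id_mem _
  comp_mem := MorphismProperty.comp_mem _
  whiskerLeft X _ _ _ hg := deterministic_whiskerLeft X hg
  whiskerRight _ hf Y := deterministic_whiskerRight hf Y
  associator_hom_mem := deterministic_associator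
  associator_inv_mem X Y Z := deterministic_inv _ (deterministic_associator X Y Z)
  leftUnitor_hom_mem := deterministic_leftUnitor
  leftUnitor_inv_mem X := deterministic_inv _ (deterministic_leftUnitor X)
  rightUnitor_hom_mem := deterministic_rightUnitor
  rightUnitor_inv_mem X := deterministic_inv _ (deterministic_rightUnitor X)
  braiding_hom_mem := deterministic_braiding
  braiding_inv_mem X Y := deterministic_inv _ (deterministic_braiding X Y)

/-- The tensor product of a Markov category restricts to the categorical product of the
subcategory of deterministic morphisms: the pairing of `f` and `g` copies its input and
applies `f` and `g` to the two copies. -/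
instance : CartesianMonoidalCategory (DetSubcategory C) where
  __ := (inferInstance : MonoidalCategory (DetSubcategory C))
  fst X Y := ⟨X.obj ◁ ε[Y.obj] ≫ (ρ_ X.obj).hom, deterministic_fst _ _⟩
  snd X Y := ⟨ε[X.obj] ▷ Y.obj ≫ (λ_ Y.obj).hom, deterministic_snd _ _⟩
  isTerminalTensorUnit := IsTerminal.ofUniqueHom
    (fun X => ⟨ε[X.obj], deterministic_discard _⟩)
    (fun X f => WideSubcategory.hom_ext _ (eq_discard _ _))
  tensorProductIsBinaryProduct X Y := BinaryFan.IsLimit.mk _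
    (fun f g => ⟨Δ ≫ (f.hom ⊗ₘ g.hom),
      deterministic_comp (deterministic_copy _) (deterministic_tensorHom _ _ f.2 g.2)⟩)
    (fun f g => WideSubcategory.hom_ext _ (pair_fst f.hom g.hom))
    (fun f g => WideSubcategory.hom_ext _ (pair_snd f.hom g.hom))
    (fun f g m h₁ h₂ => by
      subst h₁ h₂
      apply WideSubcategory.hom_ext
      have : Deterministic m.hom := m.2
      exact eq_pair (X := X.obj) (Y := Y.obj) m.hom m.2)
  fst_def X Y := by
    apply WideSubcategory.hom_ext
    change _ = (X ◁ _).hom ≫ _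
    exact congrArg (fun m => X.obj ◁ m ≫ (ρ_ X.obj).hom) (eq_discard _ _).symm
  snd_def X Y := by
    apply WideSubcategory.hom_ext
    exact congrArg (fun m => m ▷ Y.obj ≫ (λ_ Y.obj).hom) (eq_discard _ _).symm

theorem lift_hom {X Y Z : DetSubcategory C} (f : X ⟶ Y) (g : X ⟶ Z) :
    (lift f g).hom = Δ ≫ (f.hom ⊗ₘ g.hom) := rfl

end CategoryTheory.MarkovCategory

/-! ### Finite-product-preserving presheaves -/

theorem Types.nonempty_isLimit_binaryFan_iff {X Y Z : Type u} (f : Z ⟶ X) (g : Z ⟶ Y) :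
    Nonempty (IsLimit (BinaryFan.mk f g)) ↔ Function.Bijective (fun z => (f z, g z)) := by
  have hl := Types.binaryProductLimit X Y
  constructor
  · rintro ⟨h⟩
    have e := (h.conePointUniqueUpToIso hl).toEquiv.bijective
    have he : (fun z => (f z, g z)) = (h.conePointUniqueUpToIso hl).toEquiv := by
      funext z
      exact Prod.ext
        (ConcreteCategory.congr_hom (h.conePointUniqueUpToIso_hom_comp hl ⟨.left⟩) z).symm
        (ConcreteCategory.congr_hom (h.conePointUniqueUpToIso_hom_comp hl ⟨.right⟩) z).symm
    rwa [he]
  · intro h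
    refine ⟨hl.ofIsoLimit (Cone.ext (Equiv.ofBijective _ h).toIso ?_).symm⟩
    rintro ⟨_ | _⟩ <;> rfl

section Criterion

variable {D : Type*} [Category D] {z : D} {s : D → D → D}
  {inl : ∀ X Y, X ⟶ s X Y} {inr : ∀ X Y, Y ⟶ s X Y}

/-- A presheaf of sets preserves finite products as soon as it turns one initial object into a
point and one choice of binary coproducts into products. -/
theorem preservesFiniteProducts_iff_bijective (hz : IsInitial z)
    (hs : ∀ X Y, IsColimit (BinaryCofan.mk (inl X Y) (inr X Y))) (F : Dᵒᵖ ⥤ Type u) :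
    PreservesFiniteProducts F ↔
      Nonempty (Unique (F.obj (op z))) ∧ ∀ X Y, Function.Bijective
        (fun t : F.obj (op (s X Y)) => (F.map (inl X Y).op t, F.map (inr X Y).op t)) := by
  have hlim (X Y : D) : IsLimit (BinaryFan.mk (inl X Y).op (inr X Y).op) :=
    BinaryCofan.IsColimit.op (hs X Y)
  constructor
  · intro hF
    refine ⟨⟨Types.isTerminalEquivUnique _ ((terminalOpOfInitial hz).isTerminalObj F)⟩,
      fun X Y => ?_⟩
    rw [← Types.nonempty_isLimit_binaryFan_iff]
    exact ⟨mapIsLimitOfPreservesOfIsLimit F _ _ (hlim X Y)⟩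
  · rintro ⟨⟨h₀⟩, h⟩
    have : HasInitial D := hz.hasInitial
    have : HasBinaryCoproducts D := by
      have (X Y : D) : HasColimit (pair X Y) := ⟨⟨_, hs X Y⟩⟩
      exact hasBinaryCoproducts_of_hasColimit_pair D
    have : HasFiniteCoproducts D := hasFiniteCoproducts_of_has_binary_and_initial
    have : PreservesLimitsOfShape (Discrete PEmpty.{1}) F := by
      have := preservesLimit_of_preserves_limit_cone (terminalOpOfInitial hz)
        ((isLimitMapConeEmptyConeEquiv F _).symm ((Types.isTerminalEquivUnique _).symm h₀))
      exact preservesLimitsOfShape_pempty_of_preservesTerminal F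
    have : PreservesLimitsOfShape (Discrete WalkingPair) F := by
      have (X Y : Dᵒᵖ) : PreservesLimit (pair X Y) F := by
        obtain ⟨hl⟩ := (Types.nonempty_isLimit_binaryFan_iff _ _).2 (h X.unop Y.unop)
        exact preservesLimit_of_preserves_limit_cone (hlim X.unop Y.unop)
          ((isLimitMapConeBinaryFanEquiv F _ _).symm hl)
      exact ⟨fun {K} => preservesLimit_of_iso_diagram F (diagramIsoPair K).symm⟩
    exact PreservesFiniteProducts.of_preserves_binary_and_terminal F

end Criterion

/-! ### Coproducts of deterministic morphisms -/

namespace DistributiveMarkovCategory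

variable {C : Type u} [Category.{v} C] [MonoidalCategory C] [DistributiveMarkovCategory C]

/-- The copairing of two morphisms out of a chosen binary coproduct. -/
def copair {X Y Z : C} (f : X ⟶ Z) (g : Y ⟶ Z) : sum X Y ⟶ Z :=
  BinaryCofan.IsColimit.desc (sumIsColimit X Y) f g

@[simp]
theorem inl_copair {X Y Z : C} (f : X ⟶ Z) (g : Y ⟶ Z) : inl X Y ≫ copair f g = f :=
  BinaryCofan.IsColimit.inl_desc (sumIsColimit X Y) f g

@[simp]
theorem inl_copair_assoc {X Y Z W : C} (f : X ⟶ Z) (g : Y ⟶ Z) (h : Z ⟶ W) :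
    inl X Y ≫ copair f g ≫ h = f ≫ h := by
  rw [← Category.assoc, inl_copair]

@[simp]
theorem inr_copair {X Y Z : C} (f : X ⟶ Z) (g : Y ⟶ Z) : inr X Y ≫ copair f g = g :=
  BinaryCofan.IsColimit.inr_desc (sumIsColimit X Y) f g

@[simp]
theorem inr_copair_assoc {X Y Z W : C} (f : X ⟶ Z) (g : Y ⟶ Z) (h : Z ⟶ W) :
    inr X Y ≫ copair f g ≫ h = g ≫ h := by
  rw [← Category.assoc, inr_copair]

theorem sum_hom_ext {X Y Z : C} {f g : sum X Y ⟶ Z}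
    (h₁ : inl X Y ≫ f = inl X Y ≫ g) (h₂ : inr X Y ≫ f = inr X Y ≫ g) : f = g :=
  BinaryCofan.IsColimit.hom_ext (sumIsColimit X Y) h₁ h₂

end DistributiveMarkovCategory

namespace DetSubcategory

variable {C : Type u} [Category.{v} C] [MonoidalCategory C] [DistributiveMarkovCategory C]

open DistributiveMarkovCategory

theorem deterministic_desc {X Y Z : C} {f : X ⟶ Z} {g : Y ⟶ Z} (hf : Deterministic f)
    (hg : Deterministic g) : Deterministic (copair f g) := by
  have := deterministic_inl X Y
  have := deterministic_inr X Y
  refine MarkovCategory.deterministic_of_comul (sum_hom_ext ?_ ?_)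
  · rw [inl_copair_assoc, IsComonHom.hom_comul_assoc, tensorHom_comp_tensorHom, inl_copair,
      hf.hom_comul]
  · rw [inr_copair_assoc, IsComonHom.hom_comul_assoc, tensorHom_comp_tensorHom, inr_copair,
      hg.hom_comul]

theorem deterministic_zero_to (Z : C) : Deterministic (zeroIsInitial.to Z) :=
  MarkovCategory.deterministic_of_comul (zeroIsInitial.hom_ext _ _)

/-- The chosen initial object of the Markov category, in the deterministic subcategory. -/
def zero : DetSubcategory C := ⟨DistributiveMarkovCategory.zero⟩

/-- The chosen initial object stays initial among deterministic morphisms. -/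
def zeroIsInitial : IsInitial (zero : DetSubcategory C) :=
  IsInitial.ofUniqueHom (fun Z => ⟨_, deterministic_zero_to Z.obj⟩)
    (fun _ _ => WideSubcategory.hom_ext _ (DistributiveMarkovCategory.zeroIsInitial.hom_ext _ _))

/-- The chosen binary coproduct of the Markov category, in the deterministic subcategory. -/
def sum (X Y : DetSubcategory C) : DetSubcategory C := ⟨DistributiveMarkovCategory.sum X.obj Y.obj⟩

/-- The first injection into the chosen coproduct, as a deterministic morphism. -/
def inl (X Y : DetSubcategory C) : X ⟶ sum X Y := ⟨_, deterministic_inl X.obj Y.obj⟩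

/-- The second injection into the chosen coproduct, as a deterministic morphism. -/
def inr (X Y : DetSubcategory C) : Y ⟶ sum X Y := ⟨_, deterministic_inr X.obj Y.obj⟩

/-- The copairing of two deterministic morphisms, which is again deterministic. -/
def desc {X Y Z : DetSubcategory C} (f : X ⟶ Z) (g : Y ⟶ Z) : sum X Y ⟶ Z :=
  ⟨copair f.hom g.hom, deterministic_desc f.2 g.2⟩

@[simp]
theorem inl_desc {X Y Z : DetSubcategory C} (f : X ⟶ Z) (g : Y ⟶ Z) :
    inl X Y ≫ desc f g = f :=
  WideSubcategory.hom_ext _ (inl_copair f.hom g.hom)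

@[simp]
theorem inl_desc_assoc {X Y Z W : DetSubcategory C} (f : X ⟶ Z) (g : Y ⟶ Z) (h : Z ⟶ W) :
    inl X Y ≫ desc f g ≫ h = f ≫ h := by
  rw [← Category.assoc, inl_desc]

@[simp]
theorem inr_desc {X Y Z : DetSubcategory C} (f : X ⟶ Z) (g : Y ⟶ Z) :
    inr X Y ≫ desc f g = g :=
  WideSubcategory.hom_ext _ (inr_copair f.hom g.hom)

@[simp]
theorem inr_desc_assoc {X Y Z W : DetSubcategory C} (f : X ⟶ Z) (g : Y ⟶ Z) (h : Z ⟶ W) :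
    inr X Y ≫ desc f g ≫ h = g ≫ h := by
  rw [← Category.assoc, inr_desc]

theorem sum_hom_ext {X Y Z : DetSubcategory C} {f g : sum X Y ⟶ Z}
    (h₁ : inl X Y ≫ f = inl X Y ≫ g) (h₂ : inr X Y ≫ f = inr X Y ≫ g) : f = g :=
  WideSubcategory.hom_ext _ (DistributiveMarkovCategory.sum_hom_ext
    (congrArg InducedWideCategory.Hom.hom h₁) (congrArg InducedWideCategory.Hom.hom h₂))

/-- The chosen binary coproducts stay coproducts among deterministic morphisms. -/
def sumIsColimit (X Y : DetSubcategory C) : IsColimit (BinaryCofan.mk (inl X Y) (inr X Y)) :=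
  BinaryCofan.IsColimit.mk _ desc inl_desc inr_desc
    (fun f g _ h₁ h₂ => sum_hom_ext (h₁.trans (inl_desc f g).symm) (h₂.trans (inr_desc f g).symm))

/-- The coproduct of two deterministic morphisms. -/
def sumMap {X Y X' Y' : DetSubcategory C} (f : X ⟶ X') (g : Y ⟶ Y') : sum X Y ⟶ sum X' Y' :=
  desc (f ≫ inl _ _) (g ≫ inr _ _)

@[simp]
theorem inl_sumMap {X Y X' Y' : DetSubcategory C} (f : X ⟶ X') (g : Y ⟶ Y') :
    inl X Y ≫ sumMap f g = f ≫ inl X' Y' :=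
  inl_desc _ _

@[simp]
theorem inl_sumMap_assoc {X Y X' Y' Z : DetSubcategory C} (f : X ⟶ X') (g : Y ⟶ Y')
    (h : sum X' Y' ⟶ Z) : inl X Y ≫ sumMap f g ≫ h = f ≫ inl X' Y' ≫ h := by
  rw [← Category.assoc, inl_sumMap, Category.assoc]

@[simp]
theorem inr_sumMap {X Y X' Y' : DetSubcategory C} (f : X ⟶ X') (g : Y ⟶ Y') :
    inr X Y ≫ sumMap f g = g ≫ inr X' Y' :=
  inr_desc _ _

@[simp]
theorem inr_sumMap_assoc {X Y X' Y' Z : DetSubcategory C} (f : X ⟶ X') (g : Y ⟶ Y')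
    (h : sum X' Y' ⟶ Z) : inr X Y ≫ sumMap f g ≫ h = g ≫ inr X' Y' ≫ h := by
  rw [← Category.assoc, inr_sumMap, Category.assoc]

/-- The inverse of a deterministic isomorphism is deterministic. -/
theorem isIso_of_isIso_hom {X Y : DetSubcategory C} (f : X ⟶ Y) [IsIso f.hom] : IsIso f := by
  have hf : Deterministic f.hom := f.2
  exact (WideSubcategory.isoMk (P := deterministicMorphisms C) (X := X) (Y := Y)
    (asIso f.hom) hf (inferInstanceAs (IsComonHom (inv f.hom)))).isIso_hom

/-- The distributor of the deterministic subcategory. -/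
def distrib (X Y Z : DetSubcategory C) : sum (X ⊗ Z) (Y ⊗ Z) ⟶ sum X Y ⊗ Z :=
  desc (inl X Y ▷ Z) (inr X Y ▷ Z)

instance (X Y Z : DetSubcategory C) : IsIso (distrib X Y Z) := by
  have h : IsIso (distrib X Y Z).hom := isIso_distrib X.obj Y.obj Z.obj
  exact isIso_of_isIso_hom _

/-- The chosen initial object is strictly initial among deterministic morphisms. -/
noncomputable def isInitialOfHomZero {W : DetSubcategory C} (f : W ⟶ zero) : IsInitial W := by
  have h₀ : IsIso (zeroIsInitial.to ((zero : DetSubcategory C) ⊗ W)) := by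
    have h : IsIso (zeroIsInitial.to ((zero : DetSubcategory C) ⊗ W)).hom :=
      isIso_zero (C := C) W.obj
    exact isIso_of_isIso_hom _
  refine IsInitial.ofUniqueHom
    (fun Y => lift f (𝟙 W) ≫ inv (zeroIsInitial.to (zero ⊗ W)) ≫ zeroIsInitial.to Y)
    (fun Y m => ?_)
  have hm : snd zero W ≫ m = inv (zeroIsInitial.to (zero ⊗ W)) ≫ zeroIsInitial.to Y := by
    rw [IsIso.eq_inv_comp]
    exact zeroIsInitial.hom_ext _ _
  rw [← hm, lift_snd_assoc, Category.id_comp]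

end DetSubcategory

/-! ### Elements of presheaves -/

namespace FinProdPresheaf

section Elements

variable {D : Type u} [SmallCategory D]

/-- The elements of a presheaf at an object `X`. -/
def El (P : FinProdPresheaf D) (X : D) : Type u := P.obj.obj (op X)

/-- Restriction of elements along a morphism. -/
def res (P : FinProdPresheaf D) {X Y : D} (d : X ⟶ Y) (p : P.El Y) : P.El X := P.obj.map d.op p

/-- The action of a morphism of presheaves on elements. -/
def ap {P Q : FinProdPresheaf D} (f : P ⟶ Q) {X : D} (p : P.El X) : Q.El X :=
  f.hom.app (op X) p

variable {P Q R : FinProdPresheaf D}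

@[simp]
theorem res_id {X : D} (p : P.El X) : P.res (𝟙 X) p = p :=
  ConcreteCategory.congr_hom (P.obj.map_id (op X)) p

theorem res_res {X Y Z : D} (d : X ⟶ Y) (e : Y ⟶ Z) (p : P.El Z) :
    P.res d (P.res e p) = P.res (d ≫ e) p :=
  (ConcreteCategory.congr_hom (P.obj.map_comp e.op d.op) p).symm

theorem ap_res (f : P ⟶ Q) {X Y : D} (d : X ⟶ Y) (p : P.El Y) :
    ap f (P.res d p) = Q.res d (ap f p) :=
  ConcreteCategory.congr_hom (f.hom.naturality d.op) p

@[simp]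
theorem ap_id {X : D} (p : P.El X) : ap (𝟙 P) p = p := rfl

@[simp]
theorem ap_comp (f : P ⟶ Q) (g : Q ⟶ R) {X : D} (p : P.El X) : ap (f ≫ g) p = ap g (ap f p) :=
  rfl

theorem hom_ext_ap {f g : P ⟶ Q} (h : ∀ (X : D) (p : P.El X), ap f p = ap g p) : f = g := by
  ext X p
  exact h X.unop p

/-- A morphism of presheaves from its action on elements. -/
def homOfEl (φ : ∀ X, P.El X → Q.El X)
    (hφ : ∀ {X Y : D} (d : X ⟶ Y) (p : P.El Y), φ X (P.res d p) = Q.res d (φ Y p)) : P ⟶ Q :=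
  ObjectProperty.homMk
    { app := fun X => ↾(φ X.unop)
      naturality := fun _ _ d => by
        ext p
        exact hφ d.unop p }

theorem isIso_of_ap_bijective (f : P ⟶ Q)
    (h : ∀ X : D, Function.Bijective (fun p : P.El X => ap f p)) : IsIso f := by
  refine (ObjectProperty.isIso_hom_iff _).1 ?_
  have (X : Dᵒᵖ) : IsIso (f.hom.app X) := (isIso_iff_bijective _).2 (h X.unop)
  exact NatIso.isIso_of_isIso_app _

end Elements

variable {C : Type u} [SmallCategory C] [MonoidalCategory C] [DistributiveMarkovCategory C]

open DetSubcategory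

/-- A presheaf on the deterministic subcategory preserves finite products if it has one element
at the initial object and its elements at a sum are the pairs of elements at the summands. -/
theorem preserves_iff (P : (DetSubcategory C)ᵒᵖ ⥤ Type u) :
    PreservesFiniteProducts P ↔ Nonempty (Unique (P.obj (op zero))) ∧
      ∀ X Y, Function.Bijective (fun t : P.obj (op (sum X Y)) =>
        (P.map (inl X Y).op t, P.map (inr X Y).op t)) :=
  preservesFiniteProducts_iff_bijective zeroIsInitial sumIsColimit P

section Glue

variable (P : FinProdPresheaf (DetSubcategory C))

instance : Subsingleton (P.El zero) :=
  let ⟨⟨_⟩, _⟩ := (preserves_iff P.obj).1 P.property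
  inferInstanceAs (Subsingleton (P.obj.obj (op zero)))

instance : Nonempty (P.El zero) :=
  let ⟨⟨_⟩, _⟩ := (preserves_iff P.obj).1 P.property
  inferInstanceAs (Nonempty (P.obj.obj (op zero)))

/-- The unique element of a finite-product-preserving presheaf at the initial object. -/
noncomputable def elZero : P.El zero := Classical.arbitrary _

theorem eq_elZero (p : P.El zero) : p = P.elZero := Subsingleton.elim _ _

variable {P} {X Y X' Y' : DetSubcategory C}

theorem sum_ext {s t : P.El (sum X Y)} (hl : P.res (inl X Y) s = P.res (inl X Y) t)
    (hr : P.res (inr X Y) s = P.res (inr X Y) t) : s = t :=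
  (((preserves_iff P.obj).1 P.property).2 X Y).1 (Prod.ext hl hr)

theorem exists_glue (p : P.El X) (q : P.El Y) :
    ∃ s : P.El (sum X Y), P.res (inl X Y) s = p ∧ P.res (inr X Y) s = q :=
  let ⟨s, hs⟩ := (((preserves_iff P.obj).1 P.property).2 X Y).2 (p, q)
  ⟨s, congrArg Prod.fst hs, congrArg Prod.snd hs⟩

/-- The element of a finite-product-preserving presheaf at a sum with prescribed restrictions
to the two summands. -/
noncomputable def glue (p : P.El X) (q : P.El Y) : P.El (sum X Y) := (exists_glue p q).choose

@[simp]
theorem res_inl_glue (p : P.El X) (q : P.El Y) : P.res (inl X Y) (glue p q) = p :=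
  (exists_glue p q).choose_spec.1

@[simp]
theorem res_inr_glue (p : P.El X) (q : P.El Y) : P.res (inr X Y) (glue p q) = q :=
  (exists_glue p q).choose_spec.2

theorem res_sumMap_glue (d : X ⟶ X') (e : Y ⟶ Y') (p : P.El X') (q : P.El Y') :
    P.res (sumMap d e) (glue p q) = glue (P.res d p) (P.res e q) := by
  apply sum_ext
  · rw [res_res, inl_sumMap, ← res_res, res_inl_glue, res_inl_glue]
  · rw [res_res, inr_sumMap, ← res_res, res_inr_glue, res_inr_glue]

theorem res_desc {Z : DetSubcategory C} (d : X ⟶ Z) (e : Y ⟶ Z) (p : P.El Z) :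
    P.res (desc d e) p = glue (P.res d p) (P.res e p) := by
  apply sum_ext
  · rw [res_res, inl_desc, res_inl_glue]
  · rw [res_res, inr_desc, res_inr_glue]

end Glue

/-! ### The cartesian structure -/

/-- Products of presheaves are computed elementwise, and products of finite-product-preserving
presheaves preserve finite products. -/
noncomputable instance cartesianMonoidalCategory :
    CartesianMonoidalCategory (FinProdPresheaf (DetSubcategory C)) where
  __ := MonoidalCategory.fullSubcategory
      (fun F : (DetSubcategory C)ᵒᵖ ⥤ Type u => PreservesFiniteProducts F)
      ((preserves_iff _).2 ⟨⟨inferInstanceAs (Unique PUnit)⟩, fun _ _ =>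
        ⟨fun _ _ _ => rfl, fun _ => ⟨PUnit.unit, rfl⟩⟩⟩)
      (fun F G hF hG => by
        have hP := (preserves_iff F).1 hF
        have hQ := (preserves_iff G).1 hG
        obtain ⟨⟨uF⟩, hF⟩ := hP
        obtain ⟨⟨uG⟩, hG⟩ := hQ
        refine (preserves_iff _).2
          ⟨⟨⟨⟨(uF.default, uG.default)⟩,
            fun _ => Prod.ext (uF.uniq _) (uG.uniq _)⟩⟩, fun X Y => ?_⟩
        constructor
        · rintro ⟨s, s'⟩ ⟨t, t'⟩ h
          refine Prod.ext ((hF X Y).1 (Prod.ext ?_ ?_)) ((hG X Y).1 (Prod.ext ?_ ?_))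
          · exact congrArg (fun z => z.1.1) h
          · exact congrArg (fun z => z.2.1) h
          · exact congrArg (fun z => z.1.2) h
          · exact congrArg (fun z => z.2.2) h
        · rintro ⟨⟨x, x'⟩, ⟨y, y'⟩⟩
          obtain ⟨s, hs⟩ := (hF X Y).2 (x, y)
          obtain ⟨t, ht⟩ := (hG X Y).2 (x', y')
          refine ⟨(s, t), ?_⟩
          obtain ⟨rfl, rfl⟩ := Prod.ext_iff.1 hs
          obtain ⟨rfl, rfl⟩ := Prod.ext_iff.1 ht
          rfl)
  isTerminalTensorUnit := .ofUniqueHom (fun X => ObjectProperty.homMk (toUnit X.1))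
    fun _ _ => ObjectProperty.hom_ext _ (toUnit_unique _ _)
  fst X Y := ObjectProperty.homMk (fst X.1 Y.1)
  snd X Y := ObjectProperty.homMk (snd X.1 Y.1)
  tensorProductIsBinaryProduct X Y :=
    BinaryFan.IsLimit.mk _ (fun f g => ObjectProperty.homMk (lift f.hom g.hom))
      (by cat_disch) (by cat_disch) (by cat_disch)
  fst_def X Y := ObjectProperty.hom_ext _ (fst_def X.1 Y.1)
  snd_def X Y := ObjectProperty.hom_ext _ (snd_def X.1 Y.1)

section Pair

variable {P Q R S : FinProdPresheaf (DetSubcategory C)} {X Y : DetSubcategory C}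

/-- An element of a product of presheaves, given by its two components. -/
def pair (p : P.El X) (q : Q.El X) : (P ⊗ Q).El X := (Prod.mk p q : P.El X × Q.El X)

/-- The element of the terminal presheaf. -/
def star : (𝟙_ (FinProdPresheaf (DetSubcategory C))).El X := PUnit.unit

theorem pair_surjective (t : (P ⊗ Q).El X) : ∃ p q, t = pair p q := ⟨t.1, t.2, rfl⟩

instance : Subsingleton ((𝟙_ (FinProdPresheaf (DetSubcategory C))).El X) :=
  inferInstanceAs (Subsingleton PUnit)

@[simp]
theorem ap_fst_pair (p : P.El X) (q : Q.El X) : ap (fst P Q) (pair p q) = p := rfl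

@[simp]
theorem ap_snd_pair (p : P.El X) (q : Q.El X) : ap (snd P Q) (pair p q) = q := rfl

@[simp]
theorem res_pair (d : X ⟶ Y) (p : P.El Y) (q : Q.El Y) :
    (P ⊗ Q).res d (pair p q) = pair (P.res d p) (Q.res d q) := rfl

@[simp]
theorem ap_lift (f : R ⟶ P) (g : R ⟶ Q) (r : R.El X) : ap (lift f g) r = pair (ap f r) (ap g r) :=
  rfl

@[simp]
theorem ap_whiskerRight (f : P ⟶ Q) (p : P.El X) (r : R.El X) :
    ap (f ▷ R) (pair p r) = pair (ap f p) r := rfl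

theorem prod_hom_ext {f g : P ⊗ Q ⟶ R}
    (h : ∀ (X) (p : P.El X) (q : Q.El X), ap f (pair p q) = ap g (pair p q)) : f = g :=
  hom_ext_ap fun X t => h X t.1 t.2

end Pair

end FinProdPresheaf

namespace FinProdPresheaf

variable {C : Type u} [SmallCategory C] [MonoidalCategory C] [DistributiveMarkovCategory C]

open DetSubcategory

/-! ### Binary sums of presheaves -/

section Sum

variable (F G : FinProdPresheaf (DetSubcategory C))

/-- A representative of an element at `Z` of the sum of `F` and `G`: a decomposition
`Z ⟶ left + right` together with an element of `F` at `left` and an element of `G` at `right`. -/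
structure SumRep (Z : DetSubcategory C) where
  left : DetSubcategory C
  right : DetSubcategory C
  elLeft : F.El left
  elRight : G.El right
  hom : Z ⟶ sum left right

/-- The generating relation between representatives: a pair of morphisms between the summands
may act on the elements or on the decomposition. -/
inductive SumRel (Z : DetSubcategory C) : SumRep F G Z → SumRep F G Z → Prop
  | slide {X₁ X₂ Y₁ Y₂ : DetSubcategory C} (d₁ : X₁ ⟶ Y₁) (d₂ : X₂ ⟶ Y₂) (f : F.El Y₁)
      (g : G.El Y₂) (φ : Z ⟶ sum X₁ X₂) :
      SumRel Z ⟨X₁, X₂, F.res d₁ f, G.res d₂ g, φ⟩ ⟨Y₁, Y₂, f, g, φ ≫ sumMap d₁ d₂⟩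

/-- The elements at `Z` of the sum of `F` and `G`. This is the coend of
`F X₁ × G X₂ × (Z ⟶ X₁ + X₂)` over all pairs of objects `X₁`, `X₂`. -/
def SumEl (Z : DetSubcategory C) : Type u := Quot (SumRel F G Z)

namespace SumEl

variable {F G} {X₁ X₂ Y₁ Y₂ Z W : DetSubcategory C}

/-- The class of a representative. -/
def mk (f : F.El X₁) (g : G.El X₂) (φ : Z ⟶ sum X₁ X₂) : SumEl F G Z :=
  Quot.mk _ ⟨X₁, X₂, f, g, φ⟩

theorem exists_mk (t : SumEl F G Z) :
    ∃ (X₁ X₂ : DetSubcategory C) (f : F.El X₁) (g : G.El X₂) (φ : Z ⟶ sum X₁ X₂),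
      t = mk f g φ := by
  obtain ⟨r, rfl⟩ := Quot.exists_rep t
  exact ⟨r.1, r.2, r.3, r.4, r.5, rfl⟩

theorem mk_slide (d₁ : X₁ ⟶ Y₁) (d₂ : X₂ ⟶ Y₂) (f : F.El Y₁) (g : G.El Y₂)
    (φ : Z ⟶ sum X₁ X₂) :
    mk (F.res d₁ f) (G.res d₂ g) φ = mk f g (φ ≫ sumMap d₁ d₂) :=
  Quot.sound (.slide d₁ d₂ f g φ)

/-- Functions out of the elements of a sum. -/
def lift {α : Sort*} (u : ∀ {X₁ X₂ : DetSubcategory C}, F.El X₁ → G.El X₂ → (Z ⟶ sum X₁ X₂) → α)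
    (hu : ∀ {X₁ X₂ Y₁ Y₂ : DetSubcategory C} (d₁ : X₁ ⟶ Y₁) (d₂ : X₂ ⟶ Y₂) (f : F.El Y₁)
      (g : G.El Y₂) (φ : Z ⟶ sum X₁ X₂),
      u (F.res d₁ f) (G.res d₂ g) φ = u f g (φ ≫ sumMap d₁ d₂)) (t : SumEl F G Z) : α :=
  Quot.lift (fun r => u r.elLeft r.elRight r.hom)
    (by rintro _ _ ⟨d₁, d₂, f, g, φ⟩; exact hu d₁ d₂ f g φ) t

/-- Restriction of elements of a sum. -/
def res (d : W ⟶ Z) : SumEl F G Z → SumEl F G W :=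
  lift (fun f g φ => mk f g (d ≫ φ)) (fun d₁ d₂ f g φ => by
    rw [mk_slide, Category.assoc])

theorem res_mk (d : W ⟶ Z) (f : F.El X₁) (g : G.El X₂) (φ : Z ⟶ sum X₁ X₂) :
    res d (mk f g φ) = mk f g (d ≫ φ) := rfl

/-- The amalgamation of elements at two objects to an element at their sum. -/
noncomputable def amalg (s : SumEl F G Z) (t : SumEl F G W) : SumEl F G (sum Z W) :=
  lift (fun f g φ => lift (fun f' g' ψ =>
      mk (glue f f') (glue g g') (desc (φ ≫ sumMap (inl _ _) (inl _ _))
        (ψ ≫ sumMap (inr _ _) (inr _ _))))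
    (fun d₁ d₂ f' g' ψ => by
      rw [← res_id f, ← res_id g, ← res_sumMap_glue, ← res_sumMap_glue, mk_slide, res_id, res_id]
      congr 1
      apply sum_hom_ext
      · simp only [inl_desc, inl_desc_assoc, Category.assoc]
        congr 1
        apply sum_hom_ext <;> simp
      · simp only [inr_desc, inr_desc_assoc, Category.assoc]
        congr 1
        apply sum_hom_ext <;> simp) t)
    (fun d₁ d₂ f g φ => by
      obtain ⟨_, _, f', g', ψ, rfl⟩ := exists_mk t
      change mk (glue _ _) (glue _ _) _ = mk (glue _ _) (glue _ _) _
      rw [← res_id f', ← res_id g', ← res_sumMap_glue, ← res_sumMap_glue, mk_slide, res_id, res_id]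
      congr 1
      apply sum_hom_ext
      · simp only [inl_desc, inl_desc_assoc, Category.assoc]
        congr 1
        apply sum_hom_ext <;> simp
      · simp only [inr_desc, inr_desc_assoc, Category.assoc]
        congr 1
        apply sum_hom_ext <;> simp) s

theorem amalg_mk {X₁' X₂' : DetSubcategory C} (f : F.El X₁) (g : G.El X₂) (φ : Z ⟶ sum X₁ X₂)
    (f' : F.El X₁') (g' : G.El X₂') (ψ : W ⟶ sum X₁' X₂') :
    amalg (mk f g φ) (mk f' g' ψ) =
      mk (glue f f') (glue g g') (desc (φ ≫ sumMap (inl _ _) (inl _ _))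
        (ψ ≫ sumMap (inr _ _) (inr _ _))) := rfl

theorem amalg_res (t : SumEl F G (sum Z W)) :
    amalg (res (DetSubcategory.inl Z W) t) (res (DetSubcategory.inr Z W) t) = t := by
  obtain ⟨_, _, f, g, φ, rfl⟩ := exists_mk t
  rw [res_mk, res_mk, amalg_mk]
  have hf := res_desc (𝟙 _) (𝟙 _) f
  have hg := res_desc (𝟙 _) (𝟙 _) g
  rw [res_id] at hf hg
  rw [← hf, ← hg, mk_slide]
  congr 1
  apply sum_hom_ext
  · rw [inl_desc_assoc, Category.assoc, Category.assoc]
    congr 1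
    conv_rhs => rw [← Category.comp_id φ]
    congr 1
    apply sum_hom_ext <;> simp
  · rw [inr_desc_assoc, Category.assoc, Category.assoc]
    congr 1
    conv_rhs => rw [← Category.comp_id φ]
    congr 1
    apply sum_hom_ext <;> simp

theorem res_inl_amalg (s : SumEl F G Z) (t : SumEl F G W) :
    res (DetSubcategory.inl Z W) (amalg s t) = s := by
  obtain ⟨_, _, f, g, φ, rfl⟩ := exists_mk s
  obtain ⟨_, _, f', g', ψ, rfl⟩ := exists_mk t
  rw [amalg_mk, res_mk, inl_desc, ← mk_slide, res_inl_glue, res_inl_glue]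

theorem res_inr_amalg (s : SumEl F G Z) (t : SumEl F G W) :
    res (DetSubcategory.inr Z W) (amalg s t) = t := by
  obtain ⟨_, _, f, g, φ, rfl⟩ := exists_mk s
  obtain ⟨_, _, f', g', ψ, rfl⟩ := exists_mk t
  rw [amalg_mk, res_mk, inr_desc, ← mk_slide, res_inr_glue, res_inr_glue]

theorem eq_mk_zero (t : SumEl F G zero) : t = mk F.elZero G.elZero (zeroIsInitial.to _) := by
  obtain ⟨X₁, X₂, f, g, φ, rfl⟩ := exists_mk t
  rw [← F.eq_elZero (F.res (zeroIsInitial.to X₁) f), ← G.eq_elZero (G.res (zeroIsInitial.to X₂) g),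
    mk_slide]
  congr 1
  exact zeroIsInitial.hom_ext _ _

end SumEl

/-- The presheaf whose elements are those of `SumEl F G`. -/
def sumPresheaf : FinProdPresheaf (DetSubcategory C) where
  obj :=
    { obj := fun Z => SumEl F G Z.unop
      map := fun d => ↾(SumEl.res d.unop)
      map_id := fun Z => by
        ext t
        obtain ⟨_, _, f, g, φ, rfl⟩ := SumEl.exists_mk t
        exact congrArg (SumEl.mk f g) (Category.id_comp φ)
      map_comp := fun d e => by
        ext t
        obtain ⟨_, _, f, g, φ, rfl⟩ := SumEl.exists_mk t
        exact congrArg (SumEl.mk f g) (Category.assoc _ _ φ) }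
  property := (preserves_iff _).2
    ⟨⟨⟨⟨SumEl.mk F.elZero G.elZero (zeroIsInitial.to _)⟩, SumEl.eq_mk_zero⟩⟩, fun X Y =>
      ⟨fun s t h => (SumEl.amalg_res s).symm.trans
        ((congrArg₂ SumEl.amalg (congrArg Prod.fst h) (congrArg Prod.snd h)).trans
          (SumEl.amalg_res t)),
        fun p => ⟨SumEl.amalg p.1 p.2,
          Prod.ext (SumEl.res_inl_amalg _ _) (SumEl.res_inr_amalg _ _)⟩⟩⟩

end Sum

end FinProdPresheaf

namespace DetSubcategory

variable {C : Type u} [Category.{v} C] [MonoidalCategory C] [DistributiveMarkovCategory C]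

theorem distrib_fst (X Y Z : DetSubcategory C) :
    distrib X Y Z ≫ fst _ _ = sumMap (fst X Z) (fst Y Z) := by
  apply sum_hom_ext <;> simp [distrib]

theorem distrib_snd (X Y Z : DetSubcategory C) :
    distrib X Y Z ≫ snd _ _ = desc (snd X Z) (snd Y Z) := by
  apply sum_hom_ext <;> simp [distrib]

/-- A decomposition `φ : Z ⟶ X + Y` decomposes `Z` itself, as a retract of `X ⊗ Z + Y ⊗ Z`. -/
noncomputable def split {X Y Z : DetSubcategory C} (φ : Z ⟶ sum X Y) :
    Z ⟶ sum (X ⊗ Z) (Y ⊗ Z) :=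
  lift φ (𝟙 Z) ≫ inv (distrib X Y Z)

variable {X Y X' Y' Z W : DetSubcategory C}

theorem split_distrib (φ : Z ⟶ sum X Y) : split φ ≫ distrib X Y Z = lift φ (𝟙 Z) := by
  simp [split]

theorem split_unique {φ : Z ⟶ sum X Y} {s : Z ⟶ sum (X ⊗ Z) (Y ⊗ Z)}
    (h₁ : s ≫ sumMap (fst X Z) (fst Y Z) = φ) (h₂ : s ≫ desc (snd X Z) (snd Y Z) = 𝟙 Z) :
    split φ = s := by
  rw [← cancel_mono (distrib X Y Z), split_distrib]
  ext1
  · rw [lift_fst, Category.assoc, distrib_fst, h₁]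
  · rw [lift_snd, Category.assoc, distrib_snd, h₂]

theorem split_sumMap_fst (φ : Z ⟶ sum X Y) : split φ ≫ sumMap (fst X Z) (fst Y Z) = φ := by
  rw [← distrib_fst, ← Category.assoc, split_distrib, lift_fst]

theorem split_desc_snd (φ : Z ⟶ sum X Y) : split φ ≫ desc (snd X Z) (snd Y Z) = 𝟙 Z := by
  rw [← distrib_snd, ← Category.assoc, split_distrib, lift_snd]

theorem split_comp_sumMap (φ : Z ⟶ sum X Y) (d : X ⟶ X') (e : Y ⟶ Y') :
    split (φ ≫ sumMap d e) = split φ ≫ sumMap (d ▷ Z) (e ▷ Z) := by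
  apply split_unique
  · conv_rhs => rw [← split_sumMap_fst φ]
    rw [Category.assoc, Category.assoc]
    congr 1
    apply sum_hom_ext <;> simp
  · rw [← split_desc_snd φ, Category.assoc]
    congr 1
    apply sum_hom_ext <;> simp

theorem comp_split (d : W ⟶ Z) (φ : Z ⟶ sum X Y) :
    split (d ≫ φ) ≫ sumMap (X ◁ d) (Y ◁ d) = d ≫ split φ := by
  have h : sumMap (X ◁ d) (Y ◁ d) ≫ distrib X Y Z = distrib X Y W ≫ sum X Y ◁ d := by
    apply sum_hom_ext <;> simp [distrib, whisker_exchange]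
  rw [← cancel_mono (distrib X Y Z), Category.assoc, h, ← Category.assoc, split_distrib,
    Category.assoc, split_distrib]
  ext1 <;> simp

theorem split_inl (X Y : DetSubcategory C) :
    split (inl X Y) = lift (𝟙 X) (𝟙 X) ≫ inl (X ⊗ X) (Y ⊗ X) := by
  apply split_unique <;> simp

theorem split_inr (X Y : DetSubcategory C) :
    split (inr X Y) = lift (𝟙 Y) (𝟙 Y) ≫ inr (X ⊗ Y) (Y ⊗ Y) := by
  apply split_unique <;> simp

end DetSubcategory

namespace FinProdPresheaf

variable {C : Type u} [SmallCategory C] [MonoidalCategory C] [DistributiveMarkovCategory C]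

open DetSubcategory

section Sum

variable (F G : FinProdPresheaf (DetSubcategory C))

variable {F G} in
/-- The element of the sum presheaf with a given representative. -/
def sumMk {X₁ X₂ Z : DetSubcategory C} (f : F.El X₁) (g : G.El X₂) (φ : Z ⟶ sum X₁ X₂) :
    (sumPresheaf F G).El Z := SumEl.mk f g φ

variable {F G} in
theorem exists_sumMk {Z : DetSubcategory C} (t : (sumPresheaf F G).El Z) :
    ∃ (X₁ X₂ : DetSubcategory C) (f : F.El X₁) (g : G.El X₂) (φ : Z ⟶ sum X₁ X₂),
      t = sumMk f g φ :=
  SumEl.exists_mk t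

variable {F G} in
theorem res_sumMk {X₁ X₂ Z W : DetSubcategory C} (d : W ⟶ Z) (f : F.El X₁) (g : G.El X₂)
    (φ : Z ⟶ sum X₁ X₂) :
    (sumPresheaf F G).res d (sumMk f g φ) = sumMk f g (d ≫ φ) := rfl

variable {F G} in
theorem sumMk_slide {X₁ X₂ Y₁ Y₂ Z : DetSubcategory C} (d₁ : X₁ ⟶ Y₁) (d₂ : X₂ ⟶ Y₂)
    (f : F.El Y₁) (g : G.El Y₂) (φ : Z ⟶ sum X₁ X₂) :
    sumMk (F.res d₁ f) (G.res d₂ g) φ = sumMk f g (φ ≫ sumMap d₁ d₂) :=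
  SumEl.mk_slide d₁ d₂ f g φ

/-- The first injection into the sum of two presheaves. -/
noncomputable def sumInl : F ⟶ sumPresheaf F G :=
  homOfEl (fun Z f => sumMk f G.elZero (inl Z zero)) (fun {X Y} d f => by
    rw [← G.eq_elZero (G.res (𝟙 zero) G.elZero), sumMk_slide, inl_sumMap, G.eq_elZero (G.res _ _),
      res_sumMk])

/-- The second injection into the sum of two presheaves. -/
noncomputable def sumInr : G ⟶ sumPresheaf F G :=
  homOfEl (fun Z g => sumMk F.elZero g (inr zero Z)) (fun {X Y} d g => by
    rw [← F.eq_elZero (F.res (𝟙 zero) F.elZero), sumMk_slide, inr_sumMap, F.eq_elZero (F.res _ _),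
      res_sumMk])

variable {F G} {H K : FinProdPresheaf (DetSubcategory C)}

theorem ap_sumInl {X Y : DetSubcategory C} (f : F.El X) (g : G.El Y) :
    ap (sumInl F G) f = sumMk f g (inl X Y) := by
  change sumMk _ _ _ = _
  rw [← G.eq_elZero (G.res (zeroIsInitial.to Y) g)]
  conv_lhs => rw [← res_id f]
  rw [sumMk_slide, inl_sumMap, Category.id_comp]

theorem ap_sumInr {X Y : DetSubcategory C} (f : F.El X) (g : G.El Y) :
    ap (sumInr F G) g = sumMk f g (inr X Y) := by
  change sumMk _ _ _ = _
  rw [← F.eq_elZero (F.res (zeroIsInitial.to X) f)]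
  conv_lhs => rw [← res_id g]
  rw [sumMk_slide, inr_sumMap, Category.id_comp]

/-- Copairing of morphisms defined on `F ⊗ H` and `G ⊗ H`: an element of `F + G` with decomposition
`φ` and an element of `H` give elements of `F ⊗ H` and `G ⊗ H` on the two parts of `split φ`. -/
noncomputable def sumDesc (a : F ⊗ H ⟶ K) (b : G ⊗ H ⟶ K) : sumPresheaf F G ⊗ H ⟶ K :=
  homOfEl (fun Z t => SumEl.lift (fun {X₁ X₂} f g φ => K.res (split φ)
      (glue (ap a (pair (F.res (fst X₁ Z) f) (H.res (snd X₁ Z) (ap (snd _ _) t))))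
        (ap b (pair (G.res (fst X₂ Z) g) (H.res (snd X₂ Z) (ap (snd _ _) t))))))
      (fun d₁ d₂ f g φ => by
        rw [split_comp_sumMap, ← res_res, res_sumMap_glue]
        simp [← ap_res, res_res])
      (ap (fst _ _) t))
    (fun {W Z} d t => by
      obtain ⟨t, h, rfl⟩ := pair_surjective t
      obtain ⟨_, _, f, g, φ, rfl⟩ := exists_sumMk t
      rw [res_pair, res_sumMk]
      change K.res _ (glue _ _) = K.res _ (K.res _ (glue _ _))
      rw [res_res, ← comp_split, ← res_res, res_sumMap_glue]
      simp [← ap_res, res_res])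

theorem ap_sumDesc (a : F ⊗ H ⟶ K) (b : G ⊗ H ⟶ K) {X₁ X₂ Z : DetSubcategory C} (f : F.El X₁)
    (g : G.El X₂) (φ : Z ⟶ sum X₁ X₂) (h : H.El Z) :
    ap (sumDesc a b) (pair (sumMk f g φ) h) = K.res (split φ)
      (glue (ap a (pair (F.res (fst X₁ Z) f) (H.res (snd X₁ Z) h)))
        (ap b (pair (G.res (fst X₂ Z) g) (H.res (snd X₂ Z) h)))) := rfl

theorem sumInl_sumDesc (a : F ⊗ H ⟶ K) (b : G ⊗ H ⟶ K) :
    sumInl F G ▷ H ≫ sumDesc a b = a :=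
  prod_hom_ext fun X f h => by
    rw [ap_comp, ap_whiskerRight]
    change ap (sumDesc a b) (pair (sumMk f G.elZero (inl X zero)) h) = _
    rw [ap_sumDesc, split_inl, ← res_res, res_inl_glue, ← ap_res]
    simp [res_res]

theorem sumInr_sumDesc (a : F ⊗ H ⟶ K) (b : G ⊗ H ⟶ K) :
    sumInr F G ▷ H ≫ sumDesc a b = b :=
  prod_hom_ext fun X g h => by
    rw [ap_comp, ap_whiskerRight]
    change ap (sumDesc a b) (pair (sumMk F.elZero g (inr zero X)) h) = _
    rw [ap_sumDesc, split_inr, ← res_res, res_inr_glue, ← ap_res]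
    simp [res_res]

/-- An element of `(F + G) ⊗ H` is a restriction of an element at a sum, both of whose
restrictions to the summands come from `F ⊗ H` or `G ⊗ H`. -/
theorem pair_sumMk_eq_res {X₁ X₂ Z : DetSubcategory C} (f : F.El X₁) (g : G.El X₂)
    (φ : Z ⟶ sum X₁ X₂) (h : H.El Z) :
    pair (sumMk f g φ) h = (sumPresheaf F G ⊗ H).res (split φ)
      (pair (sumMk (F.res (fst X₁ Z) f) (G.res (fst X₂ Z) g) (𝟙 _))
        (H.res (desc (snd X₁ Z) (snd X₂ Z)) h)) := by
  rw [res_pair, res_sumMk, sumMk_slide, res_res, split_desc_snd, res_id, Category.comp_id,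
    split_sumMap_fst]

theorem sumPresheaf_tensor_hom_ext {m m' : sumPresheaf F G ⊗ H ⟶ K}
    (hl : sumInl F G ▷ H ≫ m = sumInl F G ▷ H ≫ m')
    (hr : sumInr F G ▷ H ≫ m = sumInr F G ▷ H ≫ m') : m = m' :=
  prod_hom_ext fun Z t h => by
    obtain ⟨X₁, X₂, f, g, φ, rfl⟩ := exists_sumMk t
    rw [pair_sumMk_eq_res, ap_res, ap_res]
    congr 1
    apply sum_ext
    · rw [← ap_res, ← ap_res, res_pair, res_sumMk, Category.comp_id, ← ap_sumInl,
        ← ap_whiskerRight, ← ap_comp, ← ap_comp, hl]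
    · rw [← ap_res, ← ap_res, res_pair, res_sumMk, Category.comp_id, ← ap_sumInr,
        ← ap_whiskerRight, ← ap_comp, ← ap_comp, hr]

variable (F G H)

/-- The sum of presheaves remains a coproduct after taking the product with any presheaf. -/
noncomputable def sumTensorIsColimit :
    IsColimit (BinaryCofan.mk (sumInl F G ▷ H) (sumInr F G ▷ H)) :=
  BinaryCofan.IsColimit.mk _ sumDesc sumInl_sumDesc sumInr_sumDesc
    (fun _ _ _ h₁ h₂ => sumPresheaf_tensor_hom_ext (h₁.trans (sumInl_sumDesc _ _).symm)
      (h₂.trans (sumInr_sumDesc _ _).symm))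

variable {F G}

/-- Copairing of morphisms of presheaves. -/
noncomputable def sumPresheafDesc (a : F ⟶ K) (b : G ⟶ K) : sumPresheaf F G ⟶ K :=
  (ρ_ _).inv ≫ sumDesc ((ρ_ _).hom ≫ a) ((ρ_ _).hom ≫ b)

theorem sumInl_sumPresheafDesc (a : F ⟶ K) (b : G ⟶ K) :
    sumInl F G ≫ sumPresheafDesc a b = a := by
  rw [sumPresheafDesc, rightUnitor_inv_naturality_assoc, sumInl_sumDesc, Iso.inv_hom_id_assoc]

theorem sumInr_sumPresheafDesc (a : F ⟶ K) (b : G ⟶ K) :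
    sumInr F G ≫ sumPresheafDesc a b = b := by
  rw [sumPresheafDesc, rightUnitor_inv_naturality_assoc, sumInr_sumDesc, Iso.inv_hom_id_assoc]

theorem sumPresheaf_hom_ext {m m' : sumPresheaf F G ⟶ K}
    (hl : sumInl F G ≫ m = sumInl F G ≫ m') (hr : sumInr F G ≫ m = sumInr F G ≫ m') :
    m = m' := by
  rw [← cancel_epi (ρ_ _).hom]
  apply sumPresheaf_tensor_hom_ext
  · rw [rightUnitor_naturality_assoc, rightUnitor_naturality_assoc, hl]
  · rw [rightUnitor_naturality_assoc, rightUnitor_naturality_assoc, hr]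

variable (F G)

/-- The sum of presheaves is their coproduct. -/
noncomputable def sumPresheafIsColimit : IsColimit (BinaryCofan.mk (sumInl F G) (sumInr F G)) :=
  BinaryCofan.IsColimit.mk _ sumPresheafDesc sumInl_sumPresheafDesc sumInr_sumPresheafDesc
    (fun _ _ _ h₁ h₂ => sumPresheaf_hom_ext (h₁.trans (sumInl_sumPresheafDesc _ _).symm)
      (h₂.trans (sumInr_sumPresheafDesc _ _).symm))

end Sum

/-! ### Representable presheaves and the distributive structure -/

section Representable

/-- The presheaf represented by an object of the deterministic subcategory. -/
def yo (X : DetSubcategory C) : FinProdPresheaf (DetSubcategory C) where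
  obj := yoneda.obj X
  property := inferInstance

variable {X Y Z W : DetSubcategory C}

/-- A morphism to `X`, as an element of the presheaf represented by `X`. -/
def yoEl (f : Z ⟶ X) : (yo X).El Z := f

@[simp]
theorem res_yoEl (d : W ⟶ Z) (f : Z ⟶ X) : (yo X).res d (yoEl f) = yoEl (d ≫ f) := rfl

variable {P : FinProdPresheaf (DetSubcategory C)}

/-- The morphism out of a representable presheaf that corresponds to an element. -/
def yoHom (p : P.El X) : yo X ⟶ P :=
  homOfEl (fun _ f => P.res f p) (fun d f => (P.res_res d f p).symm)

theorem yo_hom_ext_ap {m m' : yo X ⟶ P}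
    (h : ∀ (Z : DetSubcategory C) (f : Z ⟶ X), ap m (yoEl f) = ap m' (yoEl f)) : m = m' :=
  hom_ext_ap h

theorem yo_hom_ext {m m' : yo X ⟶ P} (h : ap m (yoEl (𝟙 X)) = ap m' (yoEl (𝟙 X))) : m = m' :=
  yo_hom_ext_ap fun Z f => by
    rw [← Category.comp_id f, ← res_yoEl, ap_res, ap_res, h]

/-- The initial object is strict, so presheaves have only one element where there is a morphism
to it. -/
theorem eq_of_hom_zero (f : W ⟶ zero) (p q : P.El W) : p = q := by
  have h : f ≫ zeroIsInitial.to W = 𝟙 W := (isInitialOfHomZero f).hom_ext _ _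
  rw [← res_id p, ← res_id q, ← h, ← res_res, ← res_res]
  congr 1
  exact Subsingleton.elim _ _

/-- The presheaf represented by the initial object is initial. -/
noncomputable def yoZeroIsInitial : IsInitial (yo (zero : DetSubcategory C)) :=
  IsInitial.ofUniqueHom (fun P => yoHom P.elZero) (fun _ _ => yo_hom_ext (Subsingleton.elim _ _))

theorem isIso_yoZero (Z : FinProdPresheaf (DetSubcategory C)) :
    IsIso (yoZeroIsInitial.to (yo zero ⊗ Z)) :=
  isIso_of_ap_bijective _ fun _ => ⟨fun p _ _ => eq_of_hom_zero p _ _,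
    fun t => ⟨ap (fst _ _) t, eq_of_hom_zero (ap (fst _ _) t : (yo zero).El _) _ _⟩⟩

end Representable

attribute [local instance] BraidedCategory.ofCartesianMonoidalCategory in
attribute [local instance] CartesianCopyDiscard.ofCartesianMonoidalCategory in
/-- Finite-product-preserving presheaves on the deterministic subcategory form a distributive
category. -/
@[reducible]
noncomputable def distributiveCategory :
    DistributiveCategory (FinProdPresheaf (DetSubcategory C)) where
  discard_natural _ := toUnit_unique _ _
  zero := yo zero
  zeroIsInitial := yoZeroIsInitial
  sum := sumPresheaf
  inl := sumInl
  inr := sumInr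
  sumIsColimit := sumPresheafIsColimit
  isIso_distrib F G H := ((sumPresheafIsColimit (F ⊗ H) (G ⊗ H)).coconePointUniqueUpToIso
    (sumTensorIsColimit F G H)).isIso_hom
  isIso_zero := isIso_yoZero
  deterministic_inl _ _ := inferInstance
  deterministic_inr _ _ := inferInstance
  deterministic _ := inferInstance

end FinProdPresheaf

/-! ### Graphs of morphisms in a Markov category -/

namespace CategoryTheory.MarkovCategory

section Graph

variable {C : Type u} [Category.{v} C] [MonoidalCategory C] [MarkovCategory C]

/-- The graph of a morphism: it runs `φ` and keeps a copy of the input. -/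
def graph {A B : C} (φ : A ⟶ B) : A ⟶ A ⊗ B := copy A ≫ A ◁ φ

theorem graph_comp {A B E : C} (φ : A ⟶ B) (ψ : B ⟶ E) :
    graph (φ ≫ ψ) = graph φ ≫ A ◁ ψ := by
  simp [graph]

theorem graph_comp_left {A A' B : C} (h : A ⟶ A') (hh : Deterministic h) (φ : A' ⟶ B) :
    graph (h ≫ φ) ≫ h ▷ B = h ≫ graph φ := by
  rw [graph, graph, copy, copy, hh.hom_comul_assoc, MonoidalCategory.tensorHom_def',
    Category.assoc, Category.assoc, MonoidalCategory.whiskerLeft_comp, Category.assoc,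
    ← whisker_exchange, whisker_exchange]

theorem graph_braiding {A B : C} (φ : A ⟶ B) : graph φ ≫ (β_ A B).hom = copy A ≫ φ ▷ A := by
  rw [graph, Category.assoc, BraidedCategory.braiding_naturality_right, ← Category.assoc,
    copy_braiding]

/-- The first marginalisation of a tensor product. -/
def proj₁ (A B : C) : A ⊗ B ⟶ A := A ◁ ε[B] ≫ (ρ_ A).hom

/-- The second marginalisation of a tensor product. -/
def proj₂ (A B : C) : A ⊗ B ⟶ B := ε[A] ▷ B ≫ (λ_ B).hom

theorem snd_hom (A B : DetSubcategory C) : (snd A B).hom = proj₂ A.obj B.obj := rfl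

theorem graph_proj₂ {A B : C} (φ : A ⟶ B) : graph φ ≫ proj₂ A B = φ := by
  have := pair_snd (𝟙 A) φ
  rwa [id_tensorHom] at this

/-- The graph of a deterministic morphism is its pairing with the identity. -/
theorem lift_id_hom {A B : DetSubcategory C} (f : A ⟶ B) :
    (lift (𝟙 A) f).hom = graph f.hom := by
  rw [lift_hom, graph, ← id_tensorHom]
  rfl

theorem copy_tensor_proj₁ (A B : C) :
    copy (A ⊗ B) ≫ proj₁ A B ▷ (A ⊗ B) = copy A ▷ B ≫ (α_ A A B).hom := by
  let A' : DetSubcategory C := ⟨A⟩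
  let B' : DetSubcategory C := ⟨B⟩
  have h : lift (fst A' B') (𝟙 (A' ⊗ B')) = lift (𝟙 A') (𝟙 A') ▷ B' ≫ (α_ A' A' B').hom :=
    CartesianMonoidalCategory.hom_ext _ _ (by
        rw [Category.assoc, associator_hom_fst, whiskerRight_fst_assoc, lift_fst, lift_fst,
          Category.comp_id])
      (CartesianMonoidalCategory.hom_ext _ _ (by
        rw [Category.assoc, Category.assoc, Category.assoc, associator_hom_snd_fst,
          whiskerRight_fst_assoc, lift_snd, lift_snd_assoc, Category.comp_id, Category.id_comp])
        (by
        rw [Category.assoc, Category.assoc, Category.assoc, associator_hom_snd_snd,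
          whiskerRight_snd, lift_snd_assoc, Category.id_comp]))
  have h₁ : copy (A ⊗ B) ≫ (proj₁ A B ⊗ₘ 𝟙 (A ⊗ B)) =
      (copy A ≫ (𝟙 A ⊗ₘ 𝟙 A)) ▷ B ≫ (α_ A A B).hom :=
    congrArg InducedWideCategory.Hom.hom h
  rwa [tensorHom_id, id_tensorHom_id, Category.comp_id] at h₁

theorem copy_tensor_proj₂ (A B : C) :
    copy (A ⊗ B) ≫ proj₂ A B ▷ (A ⊗ B) ≫ B ◁ proj₁ A B = (β_ A B).hom := by
  rw [← MonoidalCategory.tensorHom_def]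
  exact copy_projections_swap A B

/-- Running `φ` and then `ψ`, which may also use the input of `φ`, while keeping a copy of the
input throughout. -/
theorem graph_graph_proj₁ {A B E : C} (φ : A ⟶ B) (ψ : A ⊗ B ⟶ E) :
    graph φ ≫ graph ψ ≫ proj₁ A B ▷ E = graph (graph φ ≫ ψ) := by
  simp only [graph, Category.assoc, MonoidalCategory.whiskerLeft_comp]
  rw [whisker_exchange, reassoc_of% copy_tensor_proj₁, whisker_exchange_assoc, copy,
    comul_assoc_assoc]
  simp

/-- Running `φ` and then `ψ` on two copies of the input. -/
theorem graph_graph_proj₂ {A B E : C} (φ : A ⟶ B) (ψ : A ⟶ E) :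
    graph φ ≫ graph (proj₁ A B ≫ ψ) ≫ proj₂ A B ▷ E = copy A ≫ (φ ⊗ₘ ψ) := by
  rw [graph_comp, graph, graph]
  simp only [Category.assoc, whisker_exchange]
  rw [MonoidalCategory.tensorHom_def, ← reassoc_of% graph_braiding, ← copy_tensor_proj₂,
    whisker_exchange_assoc]
  simp only [graph, Category.assoc]

/-- Running `φ` and `ψ` on two copies of the input, in the other order. -/
theorem graph_graph_swap {A B E : C} (φ : A ⟶ B) (ψ : A ⟶ E) :
    graph ψ ≫ graph (proj₁ A E ≫ φ) ≫ proj₂ A E ▷ B ≫ (β_ E B).hom = copy A ≫ (φ ⊗ₘ ψ) := by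
  have h := graph_graph_proj₂ ψ φ
  rw [← Category.assoc, ← Category.assoc, Category.assoc _ _ (proj₂ A E ▷ B), h, Category.assoc,
    BraidedCategory.braiding_naturality, ← Category.assoc, copy_braiding]

end Graph

end CategoryTheory.MarkovCategory

namespace FinProdPresheaf

variable {C : Type u} [SmallCategory C] [MonoidalCategory C] [DistributiveMarkovCategory C]

open DetSubcategory CategoryTheory.MarkovCategory

/-! ### The monad of formal computations -/

section Comp

variable (P : FinProdPresheaf (DetSubcategory C))

/-- A representative of a computation at `Z` with result in `P`: a morphism `Z ⟶ B`, not
necessarily deterministic, followed by an element of `P` at `B`. -/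
structure CompRep (Z : C) where
  base : DetSubcategory C
  el : P.El base
  hom : Z ⟶ base.obj

/-- The generating relation between representatives: a deterministic morphism may act on the
element or on the morphism. -/
inductive CompRel (Z : C) : CompRep P Z → CompRep P Z → Prop
  | slide {A B : DetSubcategory C} (d : A ⟶ B) (p : P.El B) (φ : Z ⟶ A.obj) :
      CompRel Z ⟨A, P.res d p, φ⟩ ⟨B, p, φ ≫ d.hom⟩

/-- The computations at `Z` with result in `P`. This is the coend of `P B × (Z ⟶ B)` over all
objects `B` and deterministic morphisms between them, so that `CompEl P` is the left Kan extension
of `P` along the inclusion of the deterministic morphisms. -/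
def CompEl (Z : C) : Type u := Quot (CompRel P Z)

namespace CompEl

variable {P} {A B : DetSubcategory C} {Z W V : C}

/-- The class of a representative: run `φ`, then return `p`. -/
def mk (p : P.El B) (φ : Z ⟶ B.obj) : CompEl P Z := Quot.mk _ ⟨B, p, φ⟩

theorem exists_mk (t : CompEl P Z) :
    ∃ (B : DetSubcategory C) (p : P.El B) (φ : Z ⟶ B.obj), t = mk p φ := by
  obtain ⟨r, rfl⟩ := Quot.exists_rep t
  exact ⟨r.1, r.2, r.3, rfl⟩

theorem mk_slide (d : A ⟶ B) (p : P.El B) (φ : Z ⟶ A.obj) :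
    mk (P.res d p) φ = mk p (φ ≫ d.hom) :=
  Quot.sound (.slide d p φ)

/-- Functions out of the computations. -/
def lift {α : Sort*} (u : ∀ {B : DetSubcategory C}, P.El B → (Z ⟶ B.obj) → α)
    (hu : ∀ {A B : DetSubcategory C} (d : A ⟶ B) (p : P.El B) (φ : Z ⟶ A.obj),
      u (P.res d p) φ = u p (φ ≫ d.hom)) (t : CompEl P Z) : α :=
  Quot.lift (fun r => u r.el r.hom) (by rintro _ _ ⟨d, p, φ⟩; exact hu d p φ) t

/-- Precomposition of a computation with an arbitrary morphism of the Markov category. -/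
def pull (ψ : W ⟶ Z) : CompEl P Z → CompEl P W :=
  lift (fun p φ => mk p (ψ ≫ φ)) (fun d p φ => by rw [mk_slide, Category.assoc])

@[simp]
theorem pull_mk (ψ : W ⟶ Z) (p : P.El B) (φ : Z ⟶ B.obj) : pull ψ (mk p φ) = mk p (ψ ≫ φ) :=
  rfl

theorem pull_id (t : CompEl P Z) : pull (𝟙 Z) t = t := by
  obtain ⟨_, p, φ, rfl⟩ := exists_mk t
  rw [pull_mk, Category.id_comp]

theorem pull_pull (ψ : W ⟶ Z) (χ : V ⟶ W) (t : CompEl P Z) :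
    pull χ (pull ψ t) = pull (χ ≫ ψ) t := by
  obtain ⟨_, p, φ, rfl⟩ := exists_mk t
  rw [pull_mk, pull_mk, pull_mk, Category.assoc]

open DistributiveMarkovCategory in
/-- The amalgamation of computations at two objects to a computation at their sum. -/
noncomputable def amalg (s : CompEl P Z) (t : CompEl P W) :
    CompEl P (DistributiveMarkovCategory.sum Z W) :=
  lift (fun p φ => lift (fun q ψ =>
      mk (glue p q) (copair (φ ≫ (DetSubcategory.inl _ _).hom) (ψ ≫ (DetSubcategory.inr _ _).hom)))
    (fun d q ψ => by
      rw [← res_id p, ← res_sumMap_glue, mk_slide, res_id]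
      congr 1
      apply DistributiveMarkovCategory.sum_hom_ext
      · rw [inl_copair_assoc, inl_copair, Category.assoc, ← WideSubcategory.comp_def, inl_sumMap,
          Category.id_comp]
      · rw [inr_copair_assoc, inr_copair, Category.assoc, Category.assoc,
          ← WideSubcategory.comp_def, ← WideSubcategory.comp_def, inr_sumMap]) t)
    (fun d p φ => by
      obtain ⟨_, q, ψ, rfl⟩ := exists_mk t
      change mk (glue _ _) _ = mk (glue _ _) _
      rw [← res_id q, ← res_sumMap_glue, mk_slide, res_id]
      congr 1
      apply DistributiveMarkovCategory.sum_hom_ext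
      · rw [inl_copair_assoc, inl_copair, Category.assoc, Category.assoc,
          ← WideSubcategory.comp_def, ← WideSubcategory.comp_def, inl_sumMap]
      · rw [inr_copair_assoc, inr_copair, Category.assoc, ← WideSubcategory.comp_def, inr_sumMap,
          Category.id_comp]) s

open DistributiveMarkovCategory in
theorem amalg_mk (p : P.El A) (φ : Z ⟶ A.obj) (q : P.El B) (ψ : W ⟶ B.obj) :
    amalg (mk p φ) (mk q ψ) =
      mk (glue p q) (copair (φ ≫ (DetSubcategory.inl A B).hom)
        (ψ ≫ (DetSubcategory.inr A B).hom)) := rfl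

theorem amalg_pull (t : CompEl P (DistributiveMarkovCategory.sum Z W)) :
    amalg (pull (DistributiveMarkovCategory.inl Z W) t)
      (pull (DistributiveMarkovCategory.inr Z W) t) = t := by
  obtain ⟨B, p, φ, rfl⟩ := exists_mk t
  have hp := res_desc (𝟙 _) (𝟙 _) p
  rw [res_id] at hp
  rw [pull_mk, pull_mk, amalg_mk, ← hp, mk_slide]
  congr 1
  apply DistributiveMarkovCategory.sum_hom_ext
  · rw [DistributiveMarkovCategory.inl_copair_assoc, Category.assoc, Category.assoc,
      ← WideSubcategory.comp_def, inl_desc, WideSubcategory.id_def, Category.comp_id]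
  · rw [DistributiveMarkovCategory.inr_copair_assoc, Category.assoc, Category.assoc,
      ← WideSubcategory.comp_def, inr_desc, WideSubcategory.id_def, Category.comp_id]

theorem pull_inl_amalg (s : CompEl P Z) (t : CompEl P W) :
    pull (DistributiveMarkovCategory.inl Z W) (amalg s t) = s := by
  obtain ⟨_, p, φ, rfl⟩ := exists_mk s
  obtain ⟨_, q, ψ, rfl⟩ := exists_mk t
  rw [amalg_mk, pull_mk, DistributiveMarkovCategory.inl_copair, ← mk_slide, res_inl_glue]

theorem pull_inr_amalg (s : CompEl P Z) (t : CompEl P W) :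
    pull (DistributiveMarkovCategory.inr Z W) (amalg s t) = t := by
  obtain ⟨_, p, φ, rfl⟩ := exists_mk s
  obtain ⟨_, q, ψ, rfl⟩ := exists_mk t
  rw [amalg_mk, pull_mk, DistributiveMarkovCategory.inr_copair, ← mk_slide, res_inr_glue]

theorem eq_mk_zero (t : CompEl P DistributiveMarkovCategory.zero) :
    t = mk (B := zero) P.elZero (𝟙 _) := by
  obtain ⟨B, p, φ, rfl⟩ := exists_mk t
  rw [← P.eq_elZero (P.res (zeroIsInitial.to B) p), mk_slide]
  congr 1
  exact DistributiveMarkovCategory.zeroIsInitial.hom_ext _ _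

end CompEl

/-- The presheaf of computations with result in `P`. -/
def comp : FinProdPresheaf (DetSubcategory C) where
  obj :=
    { obj := fun Z => CompEl P Z.unop.obj
      map := fun d => ↾(CompEl.pull d.unop.hom)
      map_id := fun Z => by
        ext t
        exact CompEl.pull_id t
      map_comp := fun d e => by
        ext t
        exact (CompEl.pull_pull d.unop.hom e.unop.hom t).symm }
  property := (preserves_iff _).2
    ⟨⟨⟨⟨CompEl.mk (B := zero) P.elZero (𝟙 _)⟩, CompEl.eq_mk_zero⟩⟩, fun X Y =>
      ⟨fun s t h => (CompEl.amalg_pull s).symm.trans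
        ((congrArg₂ CompEl.amalg (congrArg Prod.fst h) (congrArg Prod.snd h)).trans
          (CompEl.amalg_pull t)),
        fun p => ⟨CompEl.amalg p.1 p.2,
          Prod.ext (CompEl.pull_inl_amalg _ _) (CompEl.pull_inr_amalg _ _)⟩⟩⟩

end Comp

section Monad

variable {P Q R S : FinProdPresheaf (DetSubcategory C)} {X Y Z W A B E : DetSubcategory C}

/-- The computation that runs `φ` and returns `p`. -/
def compMk (p : P.El B) (φ : Z.obj ⟶ B.obj) : (comp P).El Z := CompEl.mk p φ

/-- Precomposition of a computation with an arbitrary morphism of the Markov category. -/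
def pull (ψ : W.obj ⟶ Z.obj) (t : (comp P).El Z) : (comp P).El W := CompEl.pull ψ t

theorem exists_compMk (t : (comp P).El Z) :
    ∃ (B : DetSubcategory C) (p : P.El B) (φ : Z.obj ⟶ B.obj), t = compMk p φ :=
  CompEl.exists_mk t

theorem compMk_slide (d : A ⟶ B) (p : P.El B) (φ : Z.obj ⟶ A.obj) :
    compMk (P.res d p) φ = compMk p (φ ≫ d.hom) :=
  CompEl.mk_slide d p φ

@[simp]
theorem pull_compMk (ψ : W.obj ⟶ Z.obj) (p : P.El B) (φ : Z.obj ⟶ B.obj) :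
    pull ψ (compMk p φ) = compMk p (ψ ≫ φ) := rfl

theorem pull_pull (ψ : W.obj ⟶ Z.obj) (χ : X.obj ⟶ W.obj) (t : (comp P).El Z) :
    pull χ (pull ψ t) = pull (χ ≫ ψ) t :=
  CompEl.pull_pull ψ χ t

theorem comp_res (d : W ⟶ Z) (t : (comp P).El Z) : (comp P).res d t = pull d.hom t := rfl

/-- The pure computation that returns its argument. -/
def compUnit (P : FinProdPresheaf (DetSubcategory C)) : P ⟶ comp P :=
  homOfEl (fun Z p => compMk p (𝟙 Z.obj)) (fun d p => by
    rw [compMk_slide, comp_res, pull_compMk, Category.id_comp, Category.comp_id])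

theorem ap_compUnit (p : P.El Z) : ap (compUnit P) p = compMk p (𝟙 Z.obj) := rfl

/-- Running a second computation, which has access to the context `r` and to the result of a
first one: if the first is given by `φ : Z ⟶ B` and an element at `B`, then the second is
evaluated at `Z ⊗ B` and precomposed with the graph of `φ`. -/
noncomputable def compBindEl (g : R ⊗ P ⟶ comp Q) (r : R.El Z) :
    (comp P).El Z → (comp Q).El Z :=
  CompEl.lift (fun {B} p φ =>
      pull (W := Z) (Z := Z ⊗ B) (graph φ) (ap g (pair (R.res (fst Z B) r) (P.res (snd Z B) p))))
    (fun {A B} d p φ => by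
      have h : pair (R.res (fst Z A) r) (P.res (snd Z A) (P.res d p)) =
          (R ⊗ P).res (Z ◁ d) (pair (R.res (fst Z B) r) (P.res (snd Z B) p)) := by
        simp [res_res]
      rw [h, ap_res, comp_res, pull_pull, graph_comp]
      rfl)

theorem compBindEl_compMk (g : R ⊗ P ⟶ comp Q) (r : R.El Z) (p : P.El B) (φ : Z.obj ⟶ B.obj) :
    compBindEl g r (compMk p φ) =
      pull (W := Z) (Z := Z ⊗ B) (graph φ) (ap g (pair (R.res (fst Z B) r) (P.res (snd Z B) p))) :=
  rfl

/-- The bind operation of the monad of computations. -/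
noncomputable def compBind (f : R ⟶ comp P) (g : R ⊗ P ⟶ comp Q) : R ⟶ comp Q :=
  homOfEl (fun Z r => compBindEl g r (ap f r))
    (fun {W Z} d r => by
      rw [ap_res]
      obtain ⟨B, p, φ, h⟩ := exists_compMk (ap f r)
      rw [h, comp_res, pull_compMk, compBindEl_compMk, compBindEl_compMk, comp_res, pull_pull,
        ← graph_comp_left _ d.2]
      have h' : pair (R.res (fst W B) (R.res d r)) (P.res (snd W B) p) =
          (R ⊗ P).res (d ▷ B) (pair (R.res (fst Z B) r) (P.res (snd Z B) p)) := by
        simp [res_res]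
      rw [h', ap_res, comp_res, pull_pull]
      rfl)

theorem ap_compBind (f : R ⟶ comp P) (g : R ⊗ P ⟶ comp Q) (r : R.El Z) :
    ap (compBind f g) r = compBindEl g r (ap f r) := rfl

variable (C) in
/-- The strong monad of computations. -/
noncomputable def compMonad : StrongMonad (FinProdPresheaf (DetSubcategory C)) where
  obj := comp
  η := compUnit
  bind := compBind
  bind_natural {W Z X Y} h f g := hom_ext_ap fun A w => by
    rw [ap_comp, ap_compBind, ap_compBind, ap_comp]
    obtain ⟨B, p, φ, hp⟩ := exists_compMk (ap f (ap h w))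
    rw [hp, compBindEl_compMk, compBindEl_compMk, ap_comp, ap_whiskerRight, ap_res]
  unit_bind {Z X Y} f g := hom_ext_ap fun A z => by
    have h : graph (𝟙 A.obj) = (lift (𝟙 A) (𝟙 A)).hom := (lift_id_hom (𝟙 A)).symm
    rw [ap_compBind, ap_comp, ap_compUnit, compBindEl_compMk, h, ← comp_res, ← ap_res, ap_comp]
    simp [res_res]
  bind_unit {Z X} f := hom_ext_ap fun A z => by
    rw [ap_compBind]
    obtain ⟨B, p, φ, hp⟩ := exists_compMk (ap f z)
    rw [hp, compBindEl_compMk, ap_comp, ap_snd_pair, ap_compUnit, pull_compMk, compMk_slide,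
      Category.comp_id, snd_hom, graph_proj₂]
  bind_assoc {Z X Y W} f g h := hom_ext_ap fun A z => by
    rw [ap_compBind, ap_compBind, ap_compBind]
    obtain ⟨B, p, φ, hp⟩ := exists_compMk (ap f z)
    rw [hp, compBindEl_compMk, compBindEl_compMk, ap_compBind]
    obtain ⟨E, q, ψ, hq⟩ := exists_compMk (ap g (pair (Z.res (fst A B) z) (X.res (snd A B) p)))
    have hz : pair (Z.res (fst (A ⊗ B) E) (Z.res (fst A B) z)) (Y.res (snd (A ⊗ B) E) q) =
        (Z ⊗ Y).res (fst A B ▷ E) (pair (Z.res (fst A E) z) (Y.res (snd A E) q)) := by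
      simp [res_res]
    rw [hq, pull_compMk, compBindEl_compMk, compBindEl_compMk, ap_comp, res_pair, ap_whiskerRight,
      ap_fst_pair, hz, ap_res, comp_res, pull_pull, pull_pull]
    congr 1
    exact (graph_graph_proj₁ φ ψ).symm.trans (Category.assoc _ _ _).symm

/-- Two independent computations may be run in either order, since `⊗` is symmetric. -/
theorem compBind_comm (f : P ⟶ comp Q) (g : P ⟶ comp R) :
    compBind f (compBind (fst P Q ≫ g)
        (lift (fst (P ⊗ Q) R ≫ snd P Q) (snd (P ⊗ Q) R) ≫ compUnit (Q ⊗ R))) =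
      compBind g (compBind (fst P R ≫ f)
        (lift (snd (P ⊗ R) Q) (fst (P ⊗ R) Q ≫ snd P R) ≫ compUnit (Q ⊗ R))) := by
  refine hom_ext_ap fun A z => ?_
  rw [ap_compBind, ap_compBind]
  obtain ⟨B, p, φ, hp⟩ := exists_compMk (ap f z)
  obtain ⟨E, q, ψ, hq⟩ := exists_compMk (ap g z)
  rw [hp, hq, compBindEl_compMk, compBindEl_compMk, ap_compBind, ap_compBind, ap_comp, ap_comp,
    ap_fst_pair, ap_fst_pair, ap_res, ap_res, hp, hq, comp_res, comp_res, pull_compMk,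
    pull_compMk, compBindEl_compMk, compBindEl_compMk, ap_comp, ap_comp, ap_compUnit,
    ap_compUnit, pull_compMk, pull_compMk, pull_compMk, pull_compMk]
  have h₁ : ap (lift (fst (P ⊗ Q) R ≫ snd P Q) (snd (P ⊗ Q) R))
      (pair ((P ⊗ Q).res (fst (A ⊗ B) E) (pair (P.res (fst A B) z) (Q.res (snd A B) p)))
        (R.res (snd (A ⊗ B) E) q)) =
      (Q ⊗ R).res (snd A B ▷ E) (pair (Q.res (fst B E) p) (R.res (snd B E) q)) := by
    simp [res_res]
  have h₂ : ap (lift (snd (P ⊗ R) Q) (fst (P ⊗ R) Q ≫ snd P R))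
      (pair ((P ⊗ R).res (fst (A ⊗ E) B) (pair (P.res (fst A E) z) (R.res (snd A E) q)))
        (Q.res (snd (A ⊗ E) B) p)) =
      (Q ⊗ R).res (snd A E ▷ B ≫ (β_ E B).hom)
        (pair (Q.res (fst B E) p) (R.res (snd B E) q)) := by
    simp only [ap_lift, ap_comp, ap_fst_pair, ap_snd_pair, res_pair, res_res, Category.assoc,
      braiding_hom_fst, braiding_hom_snd,
      whiskerRight_fst, whiskerRight_snd]
  rw [h₁, h₂, compMk_slide, compMk_slide]
  congr 1
  simp only [Category.comp_id, Category.assoc]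
  exact (graph_graph_proj₂ φ ψ).trans (graph_graph_swap φ ψ).symm

instance : (compMonad C).IsCommutative where
  comm f g := compBind_comm f g

instance : (compMonad C).IsAffine where
  isIso_toUnit := by
    refine isIso_of_ap_bijective _ fun Z => ⟨fun s t _ => ?_, fun t =>
      ⟨compMk (Z := Z) (B := 𝟙_ _) star ε[Z.obj], Subsingleton.elim _ _⟩⟩
    suffices h : ∀ s : (comp (𝟙_ (FinProdPresheaf (DetSubcategory C)))).El Z,
        s = compMk (B := 𝟙_ _) star ε[Z.obj] from (h s).trans (h t).symm
    intro s
    obtain ⟨B, p, φ, rfl⟩ := exists_compMk s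
    rw [← Subsingleton.elim ((𝟙_ (FinProdPresheaf (DetSubcategory C))).res (toUnit B) star) p,
      compMk_slide]
    congr 1
    exact eq_discard _ _

end Monad

end FinProdPresheaf

/-! ### Pure morphisms in Kleisli categories -/

namespace StrongMonad.Kl

variable {A : Type u} [Category.{v} A] [CartesianMonoidalCategory A] {T : StrongMonad A}

theorem incl_map_whiskerRight {X Y : A} (f : X ⟶ Y) (Z : T.Kl) :
    (incl T).map f ▷ Z = (incl T).map (f ▷ Z.of) := by
  apply hom_ext
  change T.bind (fst X Z.of ≫ T.pure f) (T.pure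
    (lift (snd (X ⊗ Z.of) Y) (fst (X ⊗ Z.of) Y ≫ snd X Z.of))) = T.pure (f ▷ Z.of)
  rw [comp_pure, pure_bind, comp_pure]
  congr 1
  ext <;> simp

theorem whiskerLeft_incl_map {X Y : A} (f : X ⟶ Y) (Z : T.Kl) :
    Z ◁ (incl T).map f = (incl T).map (Z.of ◁ f) := by
  apply hom_ext
  change T.bind (snd Z.of X ≫ T.pure f) (T.pure
    (lift (fst (Z.of ⊗ X) Y ≫ fst Z.of X) (snd (Z.of ⊗ X) Y))) = T.pure (Z.of ◁ f)
  rw [comp_pure, pure_bind, comp_pure]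
  congr 1
  ext <;> simp

end StrongMonad.Kl

namespace FinProdPresheaf

variable {C : Type u} [SmallCategory C] [MonoidalCategory C] [DistributiveMarkovCategory C]

open DetSubcategory CategoryTheory.MarkovCategory StrongMonad

/-! ### Kleisli morphisms acting on elements -/

section Run

variable {X Y Z X' : (compMonad C).Kl} {A B : DetSubcategory C}

/-- The computation obtained by running a Kleisli morphism on an element of its source. -/
noncomputable def run (f : X ⟶ Y) (x : X.of.El A) : (comp Y.of).El A :=
  ap (P := X.of) (Q := comp Y.of) f.hom x

theorem kl_hom_ext {f g : X ⟶ Y} (h : ∀ (A : DetSubcategory C) (x : X.of.El A), run f x = run g x) :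
    f = g :=
  Kl.hom_ext (hom_ext_ap h)

theorem run_res (f : X ⟶ Y) (d : A ⟶ B) (x : X.of.El B) :
    run f (X.of.res d x) = pull d.hom (run f x) :=
  ap_res (P := X.of) (Q := comp Y.of) f.hom d x

theorem run_incl {P Q : FinProdPresheaf (DetSubcategory C)} (f : P ⟶ Q) (p : P.El A) :
    run ((Kl.incl (compMonad C)).map f) p = compMk (ap f p) (𝟙 A.obj) := rfl

/-- Kleisli composition on elements. The second morphism does not depend on the context, so the
graph in the bind operation collapses to `φ`. -/
theorem run_comp (f : X ⟶ Y) (g : Y ⟶ Z) {x : X.of.El A} {y : Y.of.El B} {φ : A.obj ⟶ B.obj}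
    (h : run f x = compMk y φ) : run (f ≫ g) x = pull φ (run g y) := by
  change compBindEl (snd X.of Y.of ≫ g.hom) x (run f x) = _
  rw [h, compBindEl_compMk]
  change pull _ (run g (Y.of.res (snd A B) y)) = _
  rw [run_res, pull_pull, snd_hom, graph_proj₂]

theorem run_incl_comp {P Q : FinProdPresheaf (DetSubcategory C)} (f : P ⟶ Q)
    (g : (Kl.incl (compMonad C)).obj Q ⟶ Z) (p : P.El A) :
    run ((Kl.incl (compMonad C)).map f ≫ g) p = run g (ap f p) := by
  rw [run_comp _ _ (run_incl f p)]
  obtain ⟨_, q, φ, h⟩ := exists_compMk (run g (ap f p))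
  rw [h, pull_compMk, Category.id_comp]

theorem run_whiskerRight (f : X ⟶ Y) {x : X.of.El A} {y : Y.of.El B} {φ : A.obj ⟶ B.obj}
    (h : run f x = compMk y φ) (x' : X'.of.El A) :
    run (f ▷ X') (pair x x' : (X.of ⊗ X'.of).El A) =
      compMk (Z := A) (B := A ⊗ B) (pair (Y.of.res (snd A B) y) (X'.of.res (fst A B) x'))
        (graph φ) := by
  change compBindEl (lift (snd (X.of ⊗ X'.of) Y.of) (fst (X.of ⊗ X'.of) Y.of ≫ snd X.of X'.of) ≫
    compUnit (Y.of ⊗ X'.of)) (pair x x') (run f x) = _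
  rw [h, compBindEl_compMk]
  exact congrArg (compMk _) (Category.comp_id _)

theorem run_whiskerLeft (f : X ⟶ Y) {x : X.of.El A} {y : Y.of.El B} {φ : A.obj ⟶ B.obj}
    (h : run f x = compMk y φ) (x' : X'.of.El A) :
    run (X' ◁ f) (pair x' x : (X'.of ⊗ X.of).El A) =
      compMk (Z := A) (B := A ⊗ B) (pair (X'.of.res (fst A B) x') (Y.of.res (snd A B) y))
        (graph φ) := by
  change compBindEl (lift (fst (X'.of ⊗ X.of) Y.of ≫ fst X'.of X.of) (snd (X'.of ⊗ X.of) Y.of) ≫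
    compUnit (X'.of ⊗ Y.of)) (pair x' x) (run f x) = _
  rw [h, compBindEl_compMk]
  exact congrArg (compMk _) (Category.comp_id _)

end Run

/-! ### The embedding into the Kleisli category -/

section Embedding

/-- A computation at `Z` with result in a representable presheaf amounts to a morphism out of
`Z`. -/
def collapse {Y Z : DetSubcategory C} : (comp (yo Y)).El Z → (Z.obj ⟶ Y.obj) :=
  CompEl.lift (fun {B} (d : B ⟶ Y) φ => φ ≫ d.hom)
    (fun {A B} (d : A ⟶ B) (e : B ⟶ Y) φ => (Category.assoc φ d.hom e.hom).symm)

/-- Every computation with result in `yo Y` has a normal form that returns the identity of `Y`;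
this is what makes the embedding full and faithful. -/
theorem compMk_collapse {Y Z : DetSubcategory C} (t : (comp (yo Y)).El Z) :
    compMk (yoEl (𝟙 Y)) (collapse t) = t := by
  obtain ⟨B, d, φ, rfl⟩ := exists_compMk t
  refine (compMk_slide (P := yo Y) d (yoEl (𝟙 Y)) φ).symm.trans ?_
  exact congrArg (fun e => compMk (yoEl e) φ) (Category.comp_id (X := B) (Y := Y) d)

theorem compMk_yoEl {Y Z B : DetSubcategory C} (d : B ⟶ Y) (φ : Z.obj ⟶ B.obj) :
    compMk (yoEl d) φ = compMk (yoEl (𝟙 Y)) (φ ≫ d.hom) :=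
  (compMk_collapse _).symm

variable (C) in
/-- The embedding of a distributive Markov category: an object is sent to the presheaf it
represents, and a morphism `f` sends a deterministic morphism `d` to the computation `d ≫ f`. -/
noncomputable def embedding : C ⥤ (compMonad C).Kl where
  obj X := ⟨yo ⟨X⟩⟩
  map {X Y} f := ⟨yoHom (X := ⟨X⟩) (P := comp (yo ⟨Y⟩)) (compMk (yoEl (𝟙 _)) f)⟩
  map_id X := Kl.hom_ext (yo_hom_ext (X := ⟨X⟩) (P := comp (yo ⟨X⟩))
    (congrArg (compMk (yoEl (𝟙 _))) (Category.id_comp (𝟙 X))))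
  map_comp {X Y Z} f g := kl_hom_ext fun A d => by
    refine Eq.trans ?_ (run_comp (Y := ⟨yo ⟨Y⟩⟩) (Z := ⟨yo ⟨Z⟩⟩) (B := ⟨Y⟩) _ _
      (y := yoEl (𝟙 _)) (φ := d.hom ≫ f) rfl).symm
    change compMk _ (d.hom ≫ f ≫ g) = compMk _ ((d.hom ≫ f) ≫ 𝟙 Y ≫ g)
    rw [Category.id_comp, Category.assoc]

variable {X Y Z : C} {A : DetSubcategory C}

theorem run_embedding (f : X ⟶ Y) (d : A ⟶ ⟨X⟩) :
    run ((embedding C).map f) (yoEl d) =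
      compMk (P := yo ⟨Y⟩) (B := ⟨Y⟩) (yoEl (𝟙 _)) (d.hom ≫ f) := rfl

/-- On deterministic morphisms the embedding is the Yoneda embedding, followed by the inclusion of
the presheaves into the Kleisli category. -/
theorem embedding_map_hom {X Y : DetSubcategory C} (d : X ⟶ Y) :
    (embedding C).map d.hom = (Kl.incl (compMonad C)).map (yoHom (yoEl d)) :=
  kl_hom_ext fun A e => by
    refine Eq.trans ?_ (compMk_yoEl (Y := Y) (e ≫ d) (𝟙 A.obj)).symm
    exact congrArg (compMk _) (Category.id_comp _).symm

instance : (embedding C).Faithful where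
  map_injective {X Y f g} h := by
    have h' := congrArg (fun m => collapse (run m (yoEl (𝟙 (⟨X⟩ : DetSubcategory C))))) h
    change (𝟙 X ≫ f) ≫ 𝟙 Y = (𝟙 X ≫ g) ≫ 𝟙 Y at h'
    simpa using h'

instance : (embedding C).Full where
  map_surjective {X Y} m := by
    refine ⟨collapse (run m (yoEl (𝟙 (⟨X⟩ : DetSubcategory C)))), Kl.hom_ext (yo_hom_ext ?_)⟩
    refine Eq.trans ?_ (compMk_collapse (run m (yoEl (𝟙 (⟨X⟩ : DetSubcategory C)))))
    exact congrArg (compMk _) (Category.id_comp _)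

/-- The tensor product of representable presheaves is represented by the tensor product. -/
noncomputable def yoTensor (X Y : DetSubcategory C) : yo X ⊗ yo Y ≅ yo (X ⊗ Y) where
  hom := homOfEl (fun _ t => yoEl (lift (ap (fst (yo X) (yo Y)) t) (ap (snd (yo X) (yo Y)) t)))
    (fun d t => by
      obtain ⟨a, b, rfl⟩ := pair_surjective t
      exact congrArg yoEl (comp_lift d a b).symm)
  inv := lift (yoHom (yoEl (fst X Y))) (yoHom (yoEl (snd X Y)))
  hom_inv_id := prod_hom_ext fun Z (a : Z ⟶ X) (b : Z ⟶ Y) =>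
    congrArg₂ (fun a b => pair (yoEl a) (yoEl b)) (lift_fst a b) (lift_snd a b)
  inv_hom_id := yo_hom_ext_ap fun Z f =>
    congrArg yoEl ((comp_lift f (fst X Y) (snd X Y)).symm.trans
      ((congrArg (f ≫ ·) lift_fst_snd).trans (Category.comp_id f)))

/-- The terminal presheaf is represented by the unit. -/
noncomputable def yoUnit : 𝟙_ (FinProdPresheaf (DetSubcategory C)) ≅ yo (𝟙_ (DetSubcategory C)) where
  hom := homOfEl (fun Z _ => yoEl (toUnit Z)) (fun d _ => congrArg yoEl (comp_toUnit d).symm)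
  inv := toUnit _
  hom_inv_id := toUnit_unique _ _
  inv_hom_id := yo_hom_ext_ap fun _ _ => toUnit_unique _ _

theorem yoTensor_associativity (X Y Z : DetSubcategory C) :
    (yoTensor X Y).hom ▷ yo Z ≫ (yoTensor (X ⊗ Y) Z).hom ≫ yoHom (yoEl (α_ X Y Z).hom) =
      (α_ (yo X) (yo Y) (yo Z)).hom ≫ yo X ◁ (yoTensor Y Z).hom ≫ (yoTensor X (Y ⊗ Z)).hom :=
  prod_hom_ext fun A t (c : A ⟶ Z) => by
    obtain ⟨(a : A ⟶ X), (b : A ⟶ Y), rfl⟩ := pair_surjective t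
    exact congrArg yoEl (lift_lift_associator_hom a b c)

theorem yoTensor_left_unitality (X : DetSubcategory C) :
    (λ_ (yo X)).hom =
      yoUnit.hom ▷ yo X ≫ (yoTensor (𝟙_ _) X).hom ≫ yoHom (yoEl (λ_ X).hom) :=
  prod_hom_ext fun A _ (a : A ⟶ X) =>
    congrArg yoEl (lift_leftUnitor_hom (toUnit A) a).symm

theorem yoTensor_right_unitality (X : DetSubcategory C) :
    (ρ_ (yo X)).hom =
      yo X ◁ yoUnit.hom ≫ (yoTensor X (𝟙_ _)).hom ≫ yoHom (yoEl (ρ_ X).hom) :=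
  prod_hom_ext fun A (a : A ⟶ X) _ =>
    congrArg yoEl (lift_rightUnitor_hom a (toUnit A)).symm

/-- Running `a ≫ f` on one copy of the input and `b` on the other, where `a` and `b` are
deterministic. -/
theorem graph_comp_lift_snd {A X X' : DetSubcategory C} {Y : C} (a : A ⟶ X) (b : A ⟶ X')
    (f : X.obj ⟶ Y) :
    graph (a.hom ≫ f) ≫ (lift (snd A ⟨Y⟩) (fst A ⟨Y⟩ ≫ b)).hom =
      (lift a b).hom ≫ f ▷ X'.obj := by
  have h : lift (snd A ⟨Y⟩) (fst A ⟨Y⟩ ≫ b) = (β_ A ⟨Y⟩).hom ≫ ⟨Y⟩ ◁ b := by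
    apply CartesianMonoidalCategory.hom_ext <;> simp only [lift_fst, lift_snd, Category.assoc,
      whiskerLeft_fst, whiskerLeft_snd, braiding_hom_fst, braiding_hom_snd_assoc]
  have h' : (lift (snd A ⟨Y⟩) (fst A ⟨Y⟩ ≫ b)).hom = (β_ A.obj Y).hom ≫ Y ◁ b.hom :=
    congrArg InducedWideCategory.Hom.hom h
  rw [h', reassoc_of% graph_braiding, lift_hom, Category.assoc, comp_whiskerRight, Category.assoc,
    MonoidalCategory.tensorHom_def, Category.assoc, whisker_exchange]

theorem graph_comp_lift_fst {A X X' : DetSubcategory C} {Y : C} (a : A ⟶ X) (b : A ⟶ X')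
    (f : X.obj ⟶ Y) :
    graph (a.hom ≫ f) ≫ (lift (fst A ⟨Y⟩ ≫ b) (snd A ⟨Y⟩)).hom =
      (lift b a).hom ≫ X'.obj ◁ f := by
  have h : lift (fst A ⟨Y⟩ ≫ b) (snd A ⟨Y⟩) = b ▷ ⟨Y⟩ := by
    apply CartesianMonoidalCategory.hom_ext <;> simp only [lift_fst, lift_snd,
      whiskerRight_fst, whiskerRight_snd]
  have h' : (lift (fst A ⟨Y⟩ ≫ b) (snd A ⟨Y⟩)).hom = b.hom ▷ Y :=
    congrArg InducedWideCategory.Hom.hom h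
  rw [h', graph, lift_hom, Category.assoc, Category.assoc, MonoidalCategory.whiskerLeft_comp,
    MonoidalCategory.tensorHom_def', Category.assoc, Category.assoc, whisker_exchange]

variable (C) in
/-- The strong monoidal structure of the embedding, the image in the Kleisli category of that of
the Yoneda embedding of the deterministic subcategory. -/
noncomputable def embeddingCoreMonoidal : (embedding C).CoreMonoidal where
  εIso := (Kl.incl (compMonad C)).mapIso yoUnit
  μIso X Y := (Kl.incl (compMonad C)).mapIso (yoTensor ⟨X⟩ ⟨Y⟩)
  μIso_hom_natural_left {X Y} f X' := by
    refine kl_hom_ext fun A t => ?_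
    obtain ⟨(a : A ⟶ ⟨X⟩), (b : A ⟶ ⟨X'⟩), rfl⟩ := pair_surjective (P := yo _) (Q := yo _) t
    refine (run_comp _ _ (run_whiskerRight _ (run_embedding f a) (yoEl b))).trans
      (Eq.trans ?_ (run_incl_comp (yoTensor ⟨X⟩ ⟨X'⟩).hom _ _).symm)
    refine (compMk_yoEl (lift (snd A ⟨Y⟩ ≫ 𝟙 _) (fst A ⟨Y⟩ ≫ b)) (graph (a.hom ≫ f) ≫ 𝟙 _)).trans
      (congrArg (compMk _) ?_)
    rw [Category.comp_id, Category.comp_id]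
    exact graph_comp_lift_snd a b f
  μIso_hom_natural_right {X Y} X' f := by
    refine kl_hom_ext fun A t => ?_
    obtain ⟨(b : A ⟶ ⟨X'⟩), (a : A ⟶ ⟨X⟩), rfl⟩ := pair_surjective (P := yo _) (Q := yo _) t
    refine (run_comp _ _ (run_whiskerLeft _ (run_embedding f a) (yoEl b))).trans
      (Eq.trans ?_ (run_incl_comp (yoTensor ⟨X'⟩ ⟨X⟩).hom _ _).symm)
    refine (compMk_yoEl (lift (fst A ⟨Y⟩ ≫ b) (snd A ⟨Y⟩ ≫ 𝟙 _)) (graph (a.hom ≫ f) ≫ 𝟙 _)).trans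
      (congrArg (compMk _) ?_)
    rw [Category.comp_id, Category.comp_id]
    exact graph_comp_lift_fst a b f
  associativity X Y Z := by
    have h := congrArg (Kl.incl (compMonad C)).map (yoTensor_associativity ⟨X⟩ ⟨Y⟩ ⟨Z⟩)
    simp only [Functor.map_comp, ← Kl.incl_map_whiskerRight _ ⟨yo ⟨Z⟩⟩,
      ← Kl.whiskerLeft_incl_map _ ⟨yo ⟨X⟩⟩, ← embedding_map_hom] at h
    exact h
  left_unitality X := by
    have h := congrArg (Kl.incl (compMonad C)).map (yoTensor_left_unitality ⟨X⟩)
    simp only [Functor.map_comp, ← Kl.incl_map_whiskerRight _ ⟨yo ⟨X⟩⟩,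
      ← embedding_map_hom] at h
    exact h
  right_unitality X := by
    have h := congrArg (Kl.incl (compMonad C)).map (yoTensor_right_unitality ⟨X⟩)
    simp only [Functor.map_comp,
      ← Kl.whiskerLeft_incl_map _ ⟨yo ⟨X⟩⟩, ← embedding_map_hom] at h
    exact h

noncomputable instance : (embedding C).Braided where
  toMonoidal := (embeddingCoreMonoidal C).toMonoidal
  braided X Y := by
    have h : (yoTensor (C := C) ⟨X⟩ ⟨Y⟩).hom ≫ yoHom (yoEl (β_ _ _).hom) =
        lift (snd (yo ⟨X⟩) (yo ⟨Y⟩)) (fst (yo ⟨X⟩) (yo ⟨Y⟩)) ≫ (yoTensor ⟨Y⟩ ⟨X⟩).hom :=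
      prod_hom_ext fun A (a : A ⟶ ⟨X⟩) (b : A ⟶ ⟨Y⟩) => congrArg yoEl (lift_braiding_hom a b)
    have h' := congrArg (Kl.incl (compMonad C)).map h
    simp only [Functor.map_comp, ← embedding_map_hom] at h'
    exact h'

theorem embedding_map_discard (X : C) :
    (embedding C).map ε[X] = ε[(embedding C).obj X] ≫ Functor.LaxMonoidal.ε (embedding C) := by
  let X' : DetSubcategory C := ⟨X⟩
  have h : yoHom (yoEl (toUnit X')) = toUnit (yo X') ≫ yoUnit.hom :=
    yo_hom_ext_ap fun A (a : A ⟶ X') => congrArg yoEl (comp_toUnit a)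
  have h' := congrArg (Kl.incl (compMonad C)).map h
  rw [Functor.map_comp, ← embedding_map_hom] at h'
  exact h'

theorem embedding_map_copy (X : C) :
    (embedding C).map Δ[X] =
      Δ[(embedding C).obj X] ≫ Functor.LaxMonoidal.μ (embedding C) X X := by
  let X' : DetSubcategory C := ⟨X⟩
  have h : yoHom (yoEl (lift (𝟙 X') (𝟙 X'))) =
      lift (𝟙 (yo X')) (𝟙 (yo X')) ≫ (yoTensor X' X').hom :=
    yo_hom_ext_ap fun A (a : A ⟶ X') => congrArg yoEl ((comp_lift a _ _).trans
      (congrArg₂ lift (Category.comp_id a) (Category.comp_id a)))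
  have h' := congrArg (Kl.incl (compMonad C)).map h
  have e : (lift (𝟙 X') (𝟙 X')).hom = copy X := by
    rw [lift_hom]
    exact (congrArg (copy X ≫ ·) (id_tensorHom_id X X)).trans (Category.comp_id _)
  rw [Functor.map_comp, ← embedding_map_hom, e] at h'
  exact h'

/-! ### Preservation of finite coproducts -/

section Coproducts

variable {X Y A : DetSubcategory C} {K : (compMonad C).Kl}

/-- Kleisli morphisms out of the image of `X` are determined by the computation obtained from the
identity of `X`, by the Yoneda lemma. -/
theorem embedding_hom_ext {m m' : (embedding C).obj X.obj ⟶ K}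
    (h : run m (yoEl (𝟙 X)) = run m' (yoEl (𝟙 X))) : m = m' :=
  Kl.hom_ext (yo_hom_ext (X := X) (P := comp K.of) h)

/-- The Kleisli morphism out of an object in the image of the embedding that corresponds to a
computation. -/
noncomputable def embeddingHom (t : (comp K.of).El X) : (embedding C).obj X.obj ⟶ K :=
  ⟨yoHom t⟩

theorem run_embeddingHom (t : (comp K.of).El X) (a : A ⟶ X) :
    run (embeddingHom t) (yoEl a) = (comp K.of).res a t := rfl

theorem run_embedding_comp (d : X ⟶ Y) (m : (embedding C).obj Y.obj ⟶ K) :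
    run ((embedding C).map d.hom ≫ m) (yoEl (𝟙 X)) = (comp K.of).res d (run m (yoEl (𝟙 Y))) := by
  refine (run_comp (B := Y) _ m (y := yoEl (𝟙 Y)) (φ := 𝟙 X.obj ≫ d.hom) rfl).trans ?_
  rw [Category.id_comp, comp_res]

/-- The image of a chosen sum is a sum in the Kleisli category, since a computation at a sum is a
pair of computations at the summands. -/
noncomputable def embeddingSumIsColimit (X Y : DetSubcategory C) :
    IsColimit (BinaryCofan.mk ((embedding C).map (DetSubcategory.inl X Y).hom)
      ((embedding C).map (DetSubcategory.inr X Y).hom)) :=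
  BinaryCofan.isColimitMk
    (fun s => embeddingHom (X := DetSubcategory.sum X Y)
      (glue (run s.inl (yoEl (𝟙 X))) (run s.inr (yoEl (𝟙 Y)))))
    (fun s => embedding_hom_ext ((run_embedding_comp _ _).trans (by
      rw [run_embeddingHom, res_id, res_inl_glue]; rfl)))
    (fun s => embedding_hom_ext ((run_embedding_comp _ _).trans (by
      rw [run_embeddingHom, res_id, res_inr_glue]; rfl)))
    (fun s m hl hr => embedding_hom_ext (X := DetSubcategory.sum X Y) (sum_ext
      ((run_embedding_comp _ _).symm.trans (by
        rw [run_embeddingHom, res_id, res_inl_glue]; exact congrArg (run · _) hl))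
      ((run_embedding_comp _ _).symm.trans (by
        rw [run_embeddingHom, res_id, res_inr_glue]; exact congrArg (run · _) hr))))

/-- The image of the initial object is initial in the Kleisli category. -/
noncomputable def embeddingZeroIsInitial :
    IsInitial ((embedding C).obj DistributiveMarkovCategory.zero) :=
  IsInitial.ofUniqueHom (fun K => embeddingHom (X := zero) (comp K.of).elZero)
    (fun _ _ => embedding_hom_ext (X := zero) (Subsingleton.elim _ _))

instance : PreservesFiniteCoproducts (embedding C) := by
  have : HasInitial C := DistributiveMarkovCategory.zeroIsInitial.hasInitial
  have : HasBinaryCoproducts C :=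
    have {X Y : C} : HasColimit (Limits.pair X Y) :=
      ⟨⟨⟨_, DistributiveMarkovCategory.sumIsColimit X Y⟩⟩⟩
    hasBinaryCoproducts_of_hasColimit_pair C
  have : HasFiniteCoproducts C := hasFiniteCoproducts_of_has_binary_and_initial
  have (X Y : C) : PreservesColimit (Limits.pair X Y) (embedding C) :=
    preservesColimit_of_preserves_colimit_cocone (DistributiveMarkovCategory.sumIsColimit X Y)
      ((isColimitMapCoconeBinaryCofanEquiv _ _ _).symm (embeddingSumIsColimit ⟨X⟩ ⟨Y⟩))
  have : PreservesColimitsOfShape (Discrete WalkingPair) (embedding C) :=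
    ⟨fun {_} => preservesColimit_of_iso_diagram _ (diagramIsoPair _).symm⟩
  have : PreservesColimit (Functor.empty.{0} C) (embedding C) :=
    preservesColimit_of_preserves_colimit_cocone DistributiveMarkovCategory.zeroIsInitial
      ((isColimitMapCoconeEmptyCoconeEquiv _ _).symm embeddingZeroIsInitial)
  have := preservesColimitsOfShape_pempty_of_preservesInitial (embedding C)
  exact ⟨fun _ => PreservesFiniteCoproducts.of_preserves_binary_and_initial _ _⟩

end Coproducts

end Embedding

end FinProdPresheaf

theorem proposition2p6 (C : Type u) [SmallCategory C] [MonoidalCategory C]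
    [DistributiveMarkovCategory C] :
    ∃ (_ : CartesianMonoidalCategory (FinProdPresheaf (DetSubcategory C)))
      (_ : Nonempty (DistributiveCategory (FinProdPresheaf (DetSubcategory C))))
      (T : StrongMonad (FinProdPresheaf (DetSubcategory C)))
      (_ : T.IsCommutative) (_ : T.IsAffine) (F : C ⥤ T.Kl) (_ : F.Braided),
      F.Full ∧ F.Faithful ∧ PreservesFiniteCoproducts F ∧
      ∀ X : C,
        F.map ε[X] = ε[F.obj X] ≫ Functor.LaxMonoidal.ε F ∧
        F.map Δ[X] = Δ[F.obj X] ≫ Functor.LaxMonoidal.μ F X X :=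
  ⟨FinProdPresheaf.cartesianMonoidalCategory, ⟨FinProdPresheaf.distributiveCategory⟩,
    FinProdPresheaf.compMonad C, inferInstance, inferInstance, FinProdPresheaf.embedding C,
    inferInstance, inferInstance, inferInstance, inferInstance, fun X =>
      ⟨FinProdPresheaf.embedding_map_discard X, FinProdPresheaf.embedding_map_copy X⟩⟩
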